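/- Let $K$ be a field. A Lie superalgebra over $K$ is a $\mathbb{Z}/2$-graded vector space $L=L_{\bar 0}\oplus L_{\bar 1}$ with an even bilinear bracket such that, for homogeneous $x,y$ and all $z$, $[x,y]=-(-1)^{|x||y|}[y,x]$ and $[x,[y,z]]=[[x,y],z]+(-1)^{|x||y|}[y,[x,z]]$, and moreover $[x,x]=0$ for $x\in L_{\bar 0}$ and $[x,[x,x]]=0$ for $x\in L_{\bar 1}$ (the last two conditions are automatic if $\operatorname{char}K\ne 2,3$). It is abelian if its bracket is zero, and its superdimension is $(\dim L_{\bar 0}\mid\dim L_{\bar 1})$. Let $\pi\colon F\to L$ be a free presentation of $L$, that is, a surjective homomorphism of Lie superalgebras where $F$ is the free Lie superalgebra over $K$ on some $\mathbb{Z}/2$-graded set, and put $R=\ker\pi$, $\gamma_1(R,F)=R$, $\gamma_{k+1}(R,F)=[\gamma_k(R,F),F]$ and $\gamma_k(F)=\gamma_k(F,F)$. The $2$-nilpotent multiplier of $L$ is $$\mathcal{M}^{(2)}(L)=\frac{R\cap\gamma_3(F)}{\gamma_3(R,F)}.$$ Let $m,n\ge 0$ be integers and let $A(m\mid n)$ be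 an abelian Lie superalgebra over $K$ of superdimension $(m\mid n)$. Then, for every free presentation of $A(m\mid n)$, the $2$-nilpotent multiplier $\mathcal{M}^{(2)}(A(m\mid n))$ is an abelian Lie superalgebra of superdimension $$\Big(\tfrac13\,(m^3+3n^2m-m)\ \Big|\ \tfrac13\,(3m^2n+n^3-n)\Big).$$ Moreover, as a $\mathbb{Z}/2$-graded vector space it is isomorphic to the component of degree $3$ (the span of the brackets of three generators) of the free Lie superalgebra over $K$ on $m$ even and $n$ odd generators. -/

import Mathlib

noncomputable section

/-- A superalgebra over the field `K`: a vector space `L = L₀ ⊕ L₁` graded by `ZMod 2`, with a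
bilinear product `br` (no identities imposed) such that `br Lᵢ Lⱼ ⊆ Lᵢ₊ⱼ`. -/
class Superalgebra (K L : Type*) [Field K] [AddCommGroup L] [Module K L] where
  /-- the homogeneous part of degree `i` -/
  part (K) : ZMod 2 → Submodule K L
  isCompl : IsCompl (part 0) (part 1)
  /-- the product -/
  br (K) : L →ₗ[K] L →ₗ[K] L
  br_mem : ∀ {i j : ZMod 2} {x y : L}, x ∈ part i → y ∈ part j → br x y ∈ part (i + j)

open Superalgebra

/-- The sign `(-1)^{ij}`. -/
def superSign (K : Type*) [Field K] (i j : ZMod 2) : K := (-1) ^ (i.val * j.val)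

/-- A Lie superalgebra over the field `K`. The last two axioms follow from the first two when
`2` and `3` are invertible in `K`; they are the usual extra requirements otherwise. -/
class LieSuperalgebra (K L : Type*) [Field K] [AddCommGroup L] [Module K L]
    [Superalgebra K L] : Prop where
  skew : ∀ {i j : ZMod 2} {x y : L}, x ∈ part K i → y ∈ part K j →
    br K x y = -(superSign K i j • br K y x)
  jacobi : ∀ {i j : ZMod 2} {x y : L} (z : L), x ∈ part K i → y ∈ part K j →
    br K x (br K y z) = br K (br K x y) z + superSign K i j • br K y (br K x z)
  even_self : ∀ {x : L}, x ∈ part K 0 → br K x x = 0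
  odd_self : ∀ {x : L}, x ∈ part K 1 → br K x (br K x x) = 0

section General

variable (K L : Type*) [Field K] [AddCommGroup L] [Module K L] [Superalgebra K L]

/-- The bracket is zero. -/
def IsAbelianSuper : Prop := ∀ x y : L, br K x y = 0

/-- `dim L = (m | n)`, that is, `dim L₀ = m` and `dim L₁ = n` (in particular `L` is
finite-dimensional). -/
def HasSuperdim (m n : ℕ) : Prop :=
  Module.rank K (part K 0 : Submodule K L) = m ∧ Module.rank K (part K 1 : Submodule K L) = n

variable {K L}

theorem Superalgebra.exists_add (x : L) :
    ∃ x₀ ∈ (part K 0 : Submodule K L), ∃ x₁ ∈ (part K 1 : Submodule K L), x₀ + x₁ = x := by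
  have h : x ∈ (part K 0 : Submodule K L) ⊔ part K 1 := by
    rw [(isCompl (K := K) (L := L)).sup_eq_top]; trivial
  exact Submodule.mem_sup.1 h

theorem Superalgebra.eq_zero_of_mem {x : L} (h₀ : x ∈ (part K 0 : Submodule K L))
    (h₁ : x ∈ (part K 1 : Submodule K L)) : x = 0 :=
  Submodule.disjoint_def.1 (isCompl (K := K) (L := L)).disjoint x h₀ h₁

theorem Superalgebra.fst_unique {x₀ x₁ y₀ y₁ : L} (hx₀ : x₀ ∈ (part K 0 : Submodule K L))
    (hx₁ : x₁ ∈ (part K 1 : Submodule K L)) (hy₀ : y₀ ∈ (part K 0 : Submodule K L))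
    (hy₁ : y₁ ∈ (part K 1 : Submodule K L)) (h : x₀ + x₁ = y₀ + y₁) : x₀ = y₀ := by
  have e : x₀ - y₀ = y₁ - x₁ := by
    rw [sub_eq_sub_iff_add_eq_add, h, add_comm]
  have := eq_zero_of_mem (K := K) (Submodule.sub_mem _ hx₀ hy₀)
    (e ▸ Submodule.sub_mem _ hy₁ hx₁)
  exact sub_eq_zero.1 this

/-- The submodule contains the homogeneous components of its elements (it is enough to ask this of
the even component). -/
def IsGradedSubmodule (N : Submodule K L) : Prop :=
  ∀ x₀ ∈ (part K 0 : Submodule K L), ∀ x₁ ∈ (part K 1 : Submodule K L), x₀ + x₁ ∈ N → x₀ ∈ N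

theorem isGradedSubmodule_of_le {N : Submodule K L}
    (h : N ≤ (N ⊓ part K 0) ⊔ (N ⊓ part K 1)) : IsGradedSubmodule N := by
  intro x₀ h₀ x₁ h₁ hx
  obtain ⟨y₀, hy₀, y₁, hy₁, e⟩ := Submodule.mem_sup.1 (h hx)
  rw [fst_unique h₀ h₁ hy₀.2 hy₁.2 e.symm]
  exact hy₀.1

theorem IsGradedSubmodule.exists_add {N : Submodule K L} (hN : IsGradedSubmodule N) {x : L}
    (hx : x ∈ N) : ∃ x₀ ∈ (part K 0 : Submodule K L), ∃ x₁ ∈ (part K 1 : Submodule K L),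
      x₀ ∈ N ∧ x₁ ∈ N ∧ x₀ + x₁ = x := by
  obtain ⟨x₀, h₀, x₁, h₁, rfl⟩ := Superalgebra.exists_add (K := K) x
  have := hN x₀ h₀ x₁ h₁ hx
  exact ⟨x₀, h₀, x₁, h₁, this, by simpa using Submodule.sub_mem _ hx this, rfl⟩

variable (K L)

/-- A two-sided graded ideal of a superalgebra. -/
structure GradedIdeal where
  /-- the underlying subspace -/
  sub : Submodule K L
  graded : IsGradedSubmodule sub
  left_mem : ∀ (a : L) {x : L}, x ∈ sub → br K a x ∈ sub
  right_mem : ∀ (a : L) {x : L}, x ∈ sub → br K x a ∈ sub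

variable {K L}

namespace GradedIdeal

/-- The whole algebra. -/
def top : GradedIdeal K L where
  sub := ⊤
  graded := fun _ _ _ _ _ => trivial
  left_mem := fun _ _ _ => trivial
  right_mem := fun _ _ _ => trivial

/-- The intersection of two graded ideals. -/
def inter (I J : GradedIdeal K L) : GradedIdeal K L where
  sub := I.sub ⊓ J.sub
  graded := fun x₀ h₀ x₁ h₁ h => ⟨I.graded x₀ h₀ x₁ h₁ h.1, J.graded x₀ h₀ x₁ h₁ h.2⟩
  left_mem := fun a _ h => ⟨I.left_mem a h.1, J.left_mem a h.2⟩
  right_mem := fun a _ h => ⟨I.right_mem a h.1, J.right_mem a h.2⟩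

/-- A graded ideal, as a superalgebra. -/
instance instSub (I : GradedIdeal K L) : Superalgebra K I.sub where
  part i := (part K i).comap I.sub.subtype
  isCompl := by
    constructor
    · rw [Submodule.disjoint_def]
      intro x h₀ h₁
      exact Subtype.ext (eq_zero_of_mem (K := K) h₀ h₁)
    · rw [codisjoint_iff, eq_top_iff]
      rintro ⟨x, hx⟩ -
      obtain ⟨x₀, h₀, x₁, h₁, k₀, k₁, rfl⟩ := I.graded.exists_add hx
      exact Submodule.mem_sup.2 ⟨⟨x₀, k₀⟩, h₀, ⟨x₁, k₁⟩, h₁, rfl⟩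
  br := LinearMap.mk₂ K (fun x y => ⟨br K (x : L) (y : L), I.left_mem _ y.2⟩)
    (fun _ _ _ => by ext; simp) (fun _ _ _ => by ext; simp)
    (fun _ _ _ => by ext; simp) (fun _ _ _ => by ext; simp)
  br_mem := fun hx hy => br_mem (K := K) hx hy

theorem coe_br (I : GradedIdeal K L) (x y : I.sub) :
    ((br K x y : I.sub) : L) = br K (x : L) (y : L) := rfl

instance instSubLie [LieSuperalgebra K L] (I : GradedIdeal K L) : LieSuperalgebra K I.sub where
  skew := fun hx hy => Subtype.ext (LieSuperalgebra.skew (K := K) (L := L) hx hy)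
  jacobi := fun z hx hy => Subtype.ext (LieSuperalgebra.jacobi (K := K) (L := L) z hx hy)
  even_self := fun hx => Subtype.ext (LieSuperalgebra.even_self (K := K) (L := L) hx)
  odd_self := fun hx => Subtype.ext (LieSuperalgebra.odd_self (K := K) (L := L) hx)

/-- The product of the quotient `L ⧸ J`. -/
def quotBr (J : GradedIdeal K L) : (L ⧸ J.sub) →ₗ[K] (L ⧸ J.sub) →ₗ[K] (L ⧸ J.sub) :=
  J.sub.liftQ
    { toFun := fun x => J.sub.mapQ J.sub (br K x) (fun _ hy => J.left_mem x hy)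
      map_add' := fun x y => by
        apply Submodule.linearMap_qext
        ext z
        simp
      map_smul' := fun c x => by
        apply Submodule.linearMap_qext
        ext z
        simp }
    (fun x hx => by
      rw [LinearMap.mem_ker]
      apply Submodule.linearMap_qext
      ext z
      simpa using J.right_mem z hx)

theorem quotBr_mkQ (J : GradedIdeal K L) (x y : L) :
    J.quotBr (J.sub.mkQ x) (J.sub.mkQ y) = J.sub.mkQ (br K x y) := rfl

/-- The quotient by a graded ideal, as a superalgebra. -/
instance instQuot (J : GradedIdeal K L) : Superalgebra K (L ⧸ J.sub) where
  part i := (part K i).map J.sub.mkQ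
  isCompl := by
    constructor
    · rw [Submodule.disjoint_def]
      rintro _ ⟨x, hx, rfl⟩ ⟨y, hy, h⟩
      have h' : x + -y ∈ J.sub := by
        rw [← sub_eq_add_neg, ← Submodule.Quotient.eq]; exact h.symm
      exact (Submodule.Quotient.mk_eq_zero _).2 (J.graded x hx (-y) (Submodule.neg_mem _ hy) h')
    · rw [codisjoint_iff, ← Submodule.map_sup, isCompl.sup_eq_top, Submodule.map_top,
        Submodule.range_mkQ]
  br := J.quotBr
  br_mem := by
    rintro i j _ _ ⟨x, hx, rfl⟩ ⟨y, hy, rfl⟩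
    exact ⟨_, br_mem hx hy, rfl⟩

theorem br_mkQ (J : GradedIdeal K L) (x y : L) :
    br K (J.sub.mkQ x) (J.sub.mkQ y) = J.sub.mkQ (br K x y) := rfl

instance instQuotLie [LieSuperalgebra K L] (J : GradedIdeal K L) :
    LieSuperalgebra K (L ⧸ J.sub) where
  skew := by
    rintro i j _ _ ⟨x, hx, rfl⟩ ⟨y, hy, rfl⟩
    rw [br_mkQ, br_mkQ, LieSuperalgebra.skew hx hy, map_neg, map_smul]
  jacobi := by
    rintro i j _ _ z ⟨x, hx, rfl⟩ ⟨y, hy, rfl⟩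
    obtain ⟨z, rfl⟩ := J.sub.mkQ_surjective z
    simp only [br_mkQ]
    rw [LieSuperalgebra.jacobi z hx hy, map_add, map_smul]
  even_self := by
    rintro _ ⟨x, hx, rfl⟩
    rw [br_mkQ, LieSuperalgebra.even_self hx, map_zero]
  odd_self := by
    rintro _ ⟨x, hx, rfl⟩
    rw [br_mkQ, br_mkQ, LieSuperalgebra.odd_self hx, map_zero]

/-- `I ∩ J` as a graded ideal of the superalgebra `I`. -/
def within (J I : GradedIdeal K L) : GradedIdeal K I.sub where
  sub := J.sub.comap I.sub.subtype
  graded := fun x₀ h₀ x₁ h₁ h => J.graded x₀ h₀ x₁ h₁ h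
  left_mem := fun a _ h => J.left_mem a h
  right_mem := fun a _ h => J.right_mem a h

variable [LieSuperalgebra K L]

/-- `[I, L]`, the span of all brackets `[x, y]` with `x ∈ I` and `y ∈ L`. -/
def bracketTop (I : GradedIdeal K L) : GradedIdeal K L := by
  have key : ∀ {i j : ZMod 2} {a x : L}, a ∈ part K i → x ∈ part K j → x ∈ I.sub → ∀ y : L,
      br K a (br K x y) ∈ Submodule.map₂ (br K) I.sub ⊤ := by
    intro i j a x ha hx hxI y
    rw [LieSuperalgebra.jacobi y ha hx]
    exact Submodule.add_mem _ (Submodule.apply_mem_map₂ _ (I.left_mem a hxI) trivial)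
      (Submodule.smul_mem _ _ (Submodule.apply_mem_map₂ _ hxI trivial))
  have left : ∀ (a : L) {x : L}, x ∈ Submodule.map₂ (br K) I.sub ⊤ →
      br K a x ∈ Submodule.map₂ (br K) I.sub ⊤ := by
    intro a x hx
    have : Submodule.map₂ (br K) I.sub ⊤ ≤
        (Submodule.map₂ (br K) I.sub ⊤).comap (br K a) := by
      rw [Submodule.map₂_le]
      intro u hu v _
      obtain ⟨u₀, k₀, u₁, k₁, h₀, h₁, rfl⟩ := I.graded.exists_add hu
      obtain ⟨a₀, l₀, a₁, l₁, rfl⟩ := Superalgebra.exists_add (K := K) a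
      simp only [Submodule.mem_comap, map_add, LinearMap.add_apply]
      exact Submodule.add_mem _
        (Submodule.add_mem _ (key l₀ k₀ h₀ v) (key l₁ k₀ h₀ v))
        (Submodule.add_mem _ (key l₀ k₁ h₁ v) (key l₁ k₁ h₁ v))
    exact this hx
  exact
  { sub := Submodule.map₂ (br K) I.sub ⊤
    graded := by
      apply isGradedSubmodule_of_le
      rw [Submodule.map₂_le]
      intro u hu v _
      obtain ⟨u₀, k₀, u₁, k₁, h₀, h₁, rfl⟩ := I.graded.exists_add hu
      obtain ⟨v₀, l₀, v₁, l₁, rfl⟩ := Superalgebra.exists_add (K := K) v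
      refine Submodule.mem_sup.2 ⟨br K u₀ v₀ + br K u₁ v₁, ⟨?_, ?_⟩, br K u₀ v₁ + br K u₁ v₀,
        ⟨?_, ?_⟩, ?_⟩
      · exact Submodule.add_mem _ (Submodule.apply_mem_map₂ _ h₀ trivial)
          (Submodule.apply_mem_map₂ _ h₁ trivial)
      · exact Submodule.add_mem _ (br_mem k₀ l₀) (br_mem k₁ l₁)
      · exact Submodule.add_mem _ (Submodule.apply_mem_map₂ _ h₀ trivial)
          (Submodule.apply_mem_map₂ _ h₁ trivial)
      · exact Submodule.add_mem _ (br_mem k₀ l₁) (br_mem k₁ l₀)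
      · simp only [map_add, LinearMap.add_apply]; abel
    left_mem := left
    right_mem := fun a x hx => by
      have hxI : x ∈ I.sub := by
        have : Submodule.map₂ (br K) I.sub ⊤ ≤ I.sub := by
          rw [Submodule.map₂_le]
          exact fun u hu v _ => I.right_mem v hu
        exact this hx
      exact Submodule.apply_mem_map₂ _ hxI trivial }

/-- `I.gamma k` is `γ_{k+1}(I, L)`: `γ₁(I, L) = I` and `γ_{k+1}(I, L) = [γ_k(I, L), L]`. In
particular `top.gamma k` is the term `γ_{k+1}(L)` of the lower central series of `L`. -/
def gamma (I : GradedIdeal K L) : ℕ → GradedIdeal K L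
  | 0 => I
  | k + 1 => (I.gamma k).bracketTop

end GradedIdeal

end General

/-- A homomorphism of (Lie) superalgebras: an even linear map that preserves brackets. -/
structure SuperHom (K F L : Type*) [Field K] [AddCommGroup F] [Module K F] [Superalgebra K F]
    [AddCommGroup L] [Module K L] [Superalgebra K L] where
  /-- the underlying linear map -/
  lin : F →ₗ[K] L
  map_part : ∀ {i : ZMod 2} {x : F}, x ∈ part K i → lin x ∈ part K i
  map_br : ∀ x y : F, lin (br K x y) = br K (lin x) (lin y)

section Multiplier

variable {K F L : Type*} [Field K] [AddCommGroup F] [Module K F] [Superalgebra K F]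
    [AddCommGroup L] [Module K L] [Superalgebra K L]

/-- The kernel of a homomorphism. -/
def SuperHom.ker (π : SuperHom K F L) : GradedIdeal K F where
  sub := LinearMap.ker π.lin
  graded := by
    intro x₀ h₀ x₁ h₁ h
    rw [LinearMap.mem_ker, map_add] at h
    have e := eq_neg_of_add_eq_zero_left h
    exact eq_zero_of_mem (K := K) (π.map_part h₀)
      (e ▸ Submodule.neg_mem _ (π.map_part h₁))
  left_mem := fun a x h => by
    rw [LinearMap.mem_ker] at h ⊢
    rw [π.map_br, h, map_zero]
  right_mem := fun a x h => by
    rw [LinearMap.mem_ker] at h ⊢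
    rw [π.map_br, h, map_zero, LinearMap.zero_apply]

/-- For `π : F → L` with kernel `R`, the superalgebra `(R ∩ γ_{c+1}(F)) / γ_{c+1}(R, F)`. When `F`
is a free Lie superalgebra and `π` is surjective (a free presentation of `L`), this is the
`c`-nilpotent multiplier of `L`, computed from this presentation. -/
abbrev NilpotentMultiplier [LieSuperalgebra K F] (c : ℕ) (π : SuperHom K F L) : Type _ :=
  (π.ker.inter (GradedIdeal.top.gamma c)).sub ⧸
    ((π.ker.gamma c).within (π.ker.inter (GradedIdeal.top.gamma c))).sub

end Multiplier

section Relators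

variable (K L : Type*) [Field K] [AddCommGroup L] [Module K L] [Superalgebra K L]

/-- The elements of a superalgebra that the Lie superalgebra axioms force to
be zero. -/
inductive LieRelator : L → Prop
  | skew (i j : ZMod 2) (x y : L) (hx : x ∈ part K i) (hy : y ∈ part K j) :
      LieRelator (br K x y + superSign K i j • br K y x)
  | jacobi (i j k : ZMod 2) (x y z : L) (hx : x ∈ part K i) (hy : y ∈ part K j)
      (hz : z ∈ part K k) :
      LieRelator (br K x (br K y z) - br K (br K x y) z - superSign K i j • br K y (br K x z))
  | even_self (x : L) (hx : x ∈ part K 0) : LieRelator (br K x x)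
  | odd_self (x : L) (hx : x ∈ part K 1) : LieRelator (br K x (br K x x))

theorem LieRelator.homogeneous {x : L} (h : LieRelator K L x) :
    ∃ i : ZMod 2, x ∈ part K i := by
  cases h with
  | skew i j x y hx hy =>
    exact ⟨i + j, Submodule.add_mem _ (br_mem hx hy)
      (Submodule.smul_mem _ _ (add_comm j i ▸ br_mem hy hx))⟩
  | jacobi i j k x y z hx hy hz =>
    refine ⟨i + (j + k), Submodule.sub_mem _ (Submodule.sub_mem _ (br_mem hx (br_mem hy hz)) ?_)
      (Submodule.smul_mem _ _ ?_)⟩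
    · exact add_assoc i j k ▸ br_mem (br_mem hx hy) hz
    · exact add_left_comm j i k ▸ br_mem hy (br_mem hx hz)
  | even_self x hx => exact ⟨_, br_mem hx hx⟩
  | odd_self x hx => exact ⟨_, br_mem hx (br_mem hx hx)⟩

/-- A subspace that contains all relators and is a two-sided ideal. -/
def IsRelatorIdeal (N : Submodule K L) : Prop :=
  (∀ x, LieRelator K L x → x ∈ N) ∧ ∀ a, ∀ x ∈ N, br K a x ∈ N ∧ br K x a ∈ N

/-- The ideal of a superalgebra that is generated by the relators. -/
def relatorIdeal : GradedIdeal K L := by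
  have rel : IsRelatorIdeal K L (sInf {N | IsRelatorIdeal K L N}) := by
    refine ⟨fun x hx => ?_, fun a x hx => ⟨?_, ?_⟩⟩
    · exact Submodule.mem_sInf.2 fun N hN => hN.1 x hx
    · exact Submodule.mem_sInf.2 fun N hN => (hN.2 a x (Submodule.mem_sInf.1 hx N hN)).1
    · exact Submodule.mem_sInf.2 fun N hN => (hN.2 a x (Submodule.mem_sInf.1 hx N hN)).2
  exact
  { sub := sInf {N | IsRelatorIdeal K L N}
    graded := by
      apply isGradedSubmodule_of_le
      refine sInf_le ⟨fun x hx => ?_, fun a x hx => ?_⟩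
      · obtain ⟨i, hi⟩ := hx.homogeneous
        have h2 : ∀ i : ZMod 2, i = 0 ∨ i = 1 := by decide
        rcases h2 i with rfl | rfl
        · exact Submodule.mem_sup_left ⟨rel.1 x hx, hi⟩
        · exact Submodule.mem_sup_right ⟨rel.1 x hx, hi⟩
      · obtain ⟨x₀, ⟨h₀, k₀⟩, x₁, ⟨h₁, k₁⟩, rfl⟩ := Submodule.mem_sup.1 hx
        obtain ⟨a₀, l₀, a₁, l₁, rfl⟩ := Superalgebra.exists_add (K := K) a
        constructor
        · refine Submodule.mem_sup.2 ⟨br K a₀ x₀ + br K a₁ x₁, ⟨?_, ?_⟩,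
            br K a₀ x₁ + br K a₁ x₀, ⟨?_, ?_⟩, ?_⟩
          · exact Submodule.add_mem _ (rel.2 _ _ h₀).1 (rel.2 _ _ h₁).1
          · exact Submodule.add_mem _ (br_mem l₀ k₀) (br_mem l₁ k₁)
          · exact Submodule.add_mem _ (rel.2 _ _ h₁).1 (rel.2 _ _ h₀).1
          · exact Submodule.add_mem _ (br_mem l₀ k₁) (br_mem l₁ k₀)
          · simp only [map_add, LinearMap.add_apply]; abel
        · refine Submodule.mem_sup.2 ⟨br K x₀ a₀ + br K x₁ a₁, ⟨?_, ?_⟩,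
            br K x₀ a₁ + br K x₁ a₀, ⟨?_, ?_⟩, ?_⟩
          · exact Submodule.add_mem _ (rel.2 _ _ h₀).2 (rel.2 _ _ h₁).2
          · exact Submodule.add_mem _ (br_mem k₀ l₀) (br_mem k₁ l₁)
          · exact Submodule.add_mem _ (rel.2 _ _ h₀).2 (rel.2 _ _ h₁).2
          · exact Submodule.add_mem _ (br_mem k₀ l₁) (br_mem k₁ l₀)
          · simp only [map_add, LinearMap.add_apply]; abel
    left_mem := fun a _ hx => (rel.2 a _ hx).1
    right_mem := fun a _ hx => (rel.2 a _ hx).2 }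

theorem relator_mem {x : L} (hx : LieRelator K L x) :
    x ∈ (relatorIdeal K L).sub :=
  Submodule.mem_sInf.2 fun _ hN => hN.1 x hx

instance instRelatorQuotLie : LieSuperalgebra K (L ⧸ (relatorIdeal K L).sub) where
  skew := by
    rintro i j _ _ ⟨x, hx, rfl⟩ ⟨y, hy, rfl⟩
    rw [eq_neg_iff_add_eq_zero]
    exact (Submodule.Quotient.mk_eq_zero _).2 (relator_mem K L (.skew i j x y hx hy))
  jacobi := by
    have key : ∀ (i j k : ZMod 2) (x y z : L), x ∈ part K i → y ∈ part K j →
        z ∈ part K k →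
        br K ((relatorIdeal K L).sub.mkQ x) (br K ((relatorIdeal K L).sub.mkQ y)
          ((relatorIdeal K L).sub.mkQ z)) =
        br K (br K ((relatorIdeal K L).sub.mkQ x) ((relatorIdeal K L).sub.mkQ y))
          ((relatorIdeal K L).sub.mkQ z) + superSign K i j •
        br K ((relatorIdeal K L).sub.mkQ y) (br K ((relatorIdeal K L).sub.mkQ x)
          ((relatorIdeal K L).sub.mkQ z)) := by
      intro i j k x y z hx hy hz
      rw [← sub_eq_zero, ← sub_sub]
      exact (Submodule.Quotient.mk_eq_zero _).2 (relator_mem K L (.jacobi i j k x y z hx hy hz))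
    rintro i j _ _ z ⟨x, hx, rfl⟩ ⟨y, hy, rfl⟩
    obtain ⟨z, rfl⟩ := (relatorIdeal K L).sub.mkQ_surjective z
    obtain ⟨z₀, h₀, z₁, h₁, rfl⟩ := Superalgebra.exists_add (K := K) z
    simp only [map_add, key i j 0 x y z₀ hx hy h₀, key i j 1 x y z₁ hx hy h₁, smul_add]
    abel
  even_self := by
    rintro _ ⟨x, hx, rfl⟩
    exact (Submodule.Quotient.mk_eq_zero _).2 (relator_mem K L (.even_self x hx))
  odd_self := by
    rintro _ ⟨x, hx, rfl⟩
    exact (Submodule.Quotient.mk_eq_zero _).2 (relator_mem K L (.odd_self x hx))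

end Relators

section Free

/-- The degree of a non-associative monomial in the graded alphabet `X`: the sum of the degrees of
its letters. -/
def monomialDegree {X : Type*} (deg : X → ZMod 2) : FreeMagma X → ZMod 2
  | .of x => deg x
  | .mul u v => monomialDegree deg u + monomialDegree deg v

variable (K : Type*) [Field K] {X : Type*}

/-- The free non-associative `K`-algebra on the set `X`, graded through `deg : X → ZMod 2`. -/
def FreeNonassoc (_deg : X → ZMod 2) : Type _ := FreeNonUnitalNonAssocAlgebra K X

variable (deg : X → ZMod 2)

instance : NonUnitalNonAssocRing (FreeNonassoc K deg) :=
  inferInstanceAs (NonUnitalNonAssocRing (FreeNonUnitalNonAssocAlgebra K X))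

instance : Module K (FreeNonassoc K deg) :=
  inferInstanceAs (Module K (FreeNonUnitalNonAssocAlgebra K X))

instance : IsScalarTower K (FreeNonassoc K deg) (FreeNonassoc K deg) :=
  inferInstanceAs (IsScalarTower K (FreeNonUnitalNonAssocAlgebra K X)
    (FreeNonUnitalNonAssocAlgebra K X))

instance : SMulCommClass K (FreeNonassoc K deg) (FreeNonassoc K deg) :=
  inferInstanceAs (SMulCommClass K (FreeNonUnitalNonAssocAlgebra K X)
    (FreeNonUnitalNonAssocAlgebra K X))

/-- A non-associative monomial, as an element of the free non-associative algebra. -/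
def monomial (w : FreeMagma X) : FreeNonassoc K deg :=
  (MonoidAlgebra.single w 1 : FreeNonUnitalNonAssocAlgebra K X)

/-- The span of a set of monomials in the free non-associative algebra. -/
def monomialSpan (s : Set (FreeMagma X)) : Submodule K (FreeNonassoc K deg) :=
  Submodule.span K (monomial K deg '' s)

theorem mem_monomialSpan (s : Set (FreeMagma X)) (x : FreeNonassoc K deg) :
    x ∈ monomialSpan K deg s ↔ ∀ w ∉ s, MonoidAlgebra.coeff x w = 0 := by
  have : monomialSpan K deg s = MonoidAlgebra.supported K K s :=
    (MonoidAlgebra.supported_eq_span_single (R := K) (s := s)).symm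
  rw [this]
  exact MonoidAlgebra.mem_supported'

/-- The free non-associative algebra as a superalgebra. -/
instance : Superalgebra K (FreeNonassoc K deg) where
  part i := monomialSpan K deg {w | monomialDegree deg w = i}
  isCompl := by
    constructor
    · rw [Submodule.disjoint_def]
      intro x h₀ h₁
      rw [mem_monomialSpan] at h₀ h₁
      apply MonoidAlgebra.coeff_injective
      ext w
      by_cases hw : monomialDegree deg w = 0
      · exact h₁ w (by simp [hw])
      · exact h₀ w hw
    · rw [codisjoint_iff, monomialSpan, monomialSpan, ← Submodule.span_union, ← Set.image_union]
      have : {w | monomialDegree deg w = 0} ∪ {w | monomialDegree deg w = 1} = Set.univ := by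
        ext w
        have : ∀ i : ZMod 2, i = 0 ∨ i = 1 := by decide
        simpa using this (monomialDegree deg w)
      rw [this, eq_top_iff]
      intro x _
      exact (mem_monomialSpan K deg Set.univ x).2 (fun w hw => absurd trivial hw)
  br := LinearMap.mul K (FreeNonassoc K deg)
  br_mem := by
    intro i j x y hx hy
    have : Submodule.map₂ (LinearMap.mul K (FreeNonassoc K deg))
        (monomialSpan K deg {w | monomialDegree deg w = i})
        (monomialSpan K deg {w | monomialDegree deg w = j}) ≤
        monomialSpan K deg {w | monomialDegree deg w = i + j} := by
      rw [monomialSpan, monomialSpan, Submodule.map₂_span_span, Submodule.span_le]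
      rintro _ ⟨_, ⟨u, hu, rfl⟩, _, ⟨v, hv, rfl⟩, rfl⟩
      refine Submodule.subset_span ⟨u * v, ?_, ?_⟩
      · have hu' : monomialDegree deg u = i := hu
        have hv' : monomialDegree deg v = j := hv
        change monomialDegree deg u + monomialDegree deg v = i + j
        rw [hu', hv']
      · exact (by rw [MonoidAlgebra.single_mul_single, one_mul] :
          (MonoidAlgebra.single (u * v) 1 : FreeNonUnitalNonAssocAlgebra K X) =
            MonoidAlgebra.single u 1 * MonoidAlgebra.single v 1)
    exact this (Submodule.apply_mem_map₂ _ hx hy)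

/-- The free Lie superalgebra `L(X)` over `K` on the set `X` graded by `deg : X → ZMod 2`. -/
abbrev FreeLieSuper : Type _ := FreeNonassoc K deg ⧸ (relatorIdeal K (FreeNonassoc K deg)).sub

instance : LieSuperalgebra K (FreeLieSuper K deg) :=
  instRelatorQuotLie K (FreeNonassoc K deg)

/-- The component of degree `d` of the free Lie superalgebra: the span of the images of all
non-associative monomials with `d` letters. -/
def lengthComponent (d : ℕ) : Submodule K (FreeLieSuper K deg) :=
  (monomialSpan K deg {w | w.length = d}).map (relatorIdeal K (FreeNonassoc K deg)).sub.mkQ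

/-- The alphabet with `m` even and `n` odd letters. -/
def stdDegree (m n : ℕ) : Fin m ⊕ Fin n → ZMod 2 := Sum.elim (fun _ => 0) (fun _ => 1)

end Free

end

/-!
The `2`-nilpotent multiplier of an abelian Lie superalgebra `L` of superdimension `(m | n)`, with
basis `b l` indexed by `m` even and `n` odd letters `l`.

Let `π : F → L` be a free presentation with kernel `R`. As `L` is abelian, `γ₂(F) ≤ R`, so that the
multiplier is `γ₃(F) / γ₃(R, F)` and `γ₄(F) ≤ γ₃(R, F)`; the latter makes it abelian. Choose
homogeneous lifts `f l` of the `b l`. Since `F` is spanned by the `f l` and `R`, the quotient is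
spanned by the triple brackets of the `f l`, and skew-symmetry and the Jacobi identity reduce these
to the basic ones `[[f b, f c], f a]` with `b < c` and `b ≤ a`
(`br_br_mem_span_hall`, `GradedIdeal.gamma_two_le_span_hall`).

The basic brackets are independent modulo `γ₃(R, F)`, in every characteristic, because their
expansions in the free associative algebra are: each of them has a word that occurs with
coefficient `±1` in it and in no other one (`dualWord_pairing`). The coefficient of a word `w` of
length three is read off as the corner entry of a representation of `F` by strictly upper
triangular `4 × 4` supermatrices, `wordRep`, in which `x` acts through the coordinates of `π x` and
which maps `R` above the superdiagonal, hence `γ₃(R, F)` to zero (`hall_independent`).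

The free Lie superalgebra on the letters is itself a free presentation of `L`, so the same
independence statement and the same reduction show that the basic brackets of the letters are a
basis of its component of degree `3`. Both spaces thus have homogeneous bases indexed by the same
triples with the same parities. Finally, among the three cyclic rotations of a non-constant triple
of letters exactly one is basic, so three times the number of basic triples of a given parity is
the number of all triples of that parity minus the number of letters of that parity
(`three_mul_card_hall`).
-/

noncomputable section

open Superalgebra

/-! ### Signs -/

theorem superSign_comm (K : Type*) [Field K] (i j : ZMod 2) :
    superSign K i j = superSign K j i := by
  rw [superSign, superSign, mul_comm]

theorem superSign_eq_one_or (K : Type*) [Field K] (i j : ZMod 2) :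
    superSign K i j = 1 ∨ superSign K i j = -1 :=
  neg_one_pow_eq_or K _

theorem superSign_mul_self (K : Type*) [Field K] (i j : ZMod 2) :
    superSign K i j * superSign K i j = 1 := by
  rcases superSign_eq_one_or K i j with h | h <;> simp [h]

theorem superSign_zero_left (K : Type*) [Field K] (j : ZMod 2) : superSign K 0 j = 1 := by
  simp [superSign]

theorem superSign_zero_right (K : Type*) [Field K] (j : ZMod 2) : superSign K j 0 = 1 := by
  simp [superSign]

theorem superSign_one_one (K : Type*) [Field K] : superSign K 1 1 = -1 := by
  simp [superSign, ZMod.val_one]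

theorem superSign_add_right (K : Type*) [Field K] (i j k : ZMod 2) :
    superSign K i (j + k) = superSign K i j * superSign K i k := by
  have h2 : ∀ i : ZMod 2, i = 0 ∨ i = 1 := by decide
  have h11 : (1 + 1 : ZMod 2) = 0 := by decide
  rcases h2 i with rfl | rfl <;> rcases h2 j with rfl | rfl <;> rcases h2 k with rfl | rfl <;>
    simp [superSign_zero_left, superSign_zero_right, superSign_one_one, h11]

theorem superSign_add_left (K : Type*) [Field K] (i j k : ZMod 2) :
    superSign K (i + j) k = superSign K i k * superSign K j k := by
  rw [superSign_comm, superSign_add_right, superSign_comm K k, superSign_comm K k]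

/-! ### The general linear Lie superalgebra -/

/-- The matrices over `K` with rows and columns indexed by a set graded by `p`; as a Lie
superalgebra this is `gl(p)` with the supercommutator as its bracket. -/
def SuperMatrix (K : Type*) {N : Type*} (_p : N → ZMod 2) : Type _ := Matrix N N K

namespace SuperMatrix

variable {K : Type*} [Field K] {N : Type*} [Fintype N] [DecidableEq N] {p : N → ZMod 2}

instance : Ring (SuperMatrix K p) := inferInstanceAs (Ring (Matrix N N K))

instance : Algebra K (SuperMatrix K p) := inferInstanceAs (Algebra K (Matrix N N K))


/-- The matrices of parity `i`: the entry at `(a, b)` has parity `p a + p b`. -/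
def parity (p : N → ZMod 2) (i : ZMod 2) : Submodule K (SuperMatrix K p) where
  carrier := {M | ∀ a b, p a + p b ≠ i → M a b = 0}
  add_mem' := fun {x y} hx hy a b h => by
    change x a b + y a b = 0
    rw [hx a b h, hy a b h, add_zero]
  zero_mem' := fun _ _ _ => rfl
  smul_mem' := fun c x hx a b h => by
    change c * x a b = 0
    rw [hx a b h, mul_zero]

/-- The supercommutator. The sign in front of the product of two matrix entries is given by their
parities, which makes the formula bilinear. -/
def superBr : SuperMatrix K p →ₗ[K] SuperMatrix K p →ₗ[K] SuperMatrix K p :=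
  LinearMap.mk₂ K
    (fun x y a b => ∑ k, (x a k * y k b - superSign K (p a + p k) (p k + p b) * (y a k * x k b)))
    (fun x x' y => by
      funext a b
      refine Eq.trans ?_ Finset.sum_add_distrib
      refine Finset.sum_congr rfl fun k _ => ?_
      change (x a k + x' a k) * _ - _ * (_ * (x k b + x' k b)) = _
      ring)
    (fun c x y => by
      funext a b
      refine Eq.trans ?_ (Finset.mul_sum _ _ _).symm
      refine Finset.sum_congr rfl fun k _ => ?_
      change (c * x a k) * _ - _ * (_ * (c * x k b)) = _
      ring)
    (fun x y y' => by
      funext a b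
      refine Eq.trans ?_ Finset.sum_add_distrib
      refine Finset.sum_congr rfl fun k _ => ?_
      change _ * (y k b + y' k b) - _ * ((y a k + y' a k) * _) = _
      ring)
    (fun c x y => by
      funext a b
      refine Eq.trans ?_ (Finset.mul_sum _ _ _).symm
      refine Finset.sum_congr rfl fun k _ => ?_
      change _ * (c * y k b) - _ * ((c * y a k) * _) = _
      ring)

theorem superBr_apply (x y : SuperMatrix K p) (a b : N) : superBr x y a b =
    ∑ k, (x a k * y k b - superSign K (p a + p k) (p k + p b) * (y a k * x k b)) := rfl

theorem superBr_eq {i j : ZMod 2} {x y : SuperMatrix K p} (hx : x ∈ parity p i)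
    (hy : y ∈ parity p j) : superBr x y = x * y - superSign K i j • (y * x) := by
  funext a b
  change _ = (∑ k, x a k * y k b) - superSign K i j * ∑ k, y a k * x k b
  rw [superBr_apply, Finset.mul_sum, ← Finset.sum_sub_distrib]
  refine Finset.sum_congr rfl fun k _ => ?_
  by_cases h1 : p a + p k = j
  · by_cases h2 : p k + p b = i
    · rw [h1, h2, superSign_comm]
    · rw [hx k b h2]; simp
  · rw [hy a k h1]; simp

theorem mul_mem_parity {i j : ZMod 2} {x y : SuperMatrix K p} (hx : x ∈ parity p i)
    (hy : y ∈ parity p j) : x * y ∈ parity p (i + j) := by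
  intro a b h
  refine Finset.sum_eq_zero fun k _ => ?_
  by_cases h1 : p a + p k = i
  · have h2 : p k + p b ≠ j := by
      rintro rfl
      apply h
      have h2 : ∀ a b k : ZMod 2, a + b = a + k + (k + b) := by decide
      rw [← h1, ← h2]
    change x a k * y k b = 0
    rw [hy k b h2, mul_zero]
  · change x a k * y k b = 0
    rw [hx a k h1, zero_mul]

instance : Superalgebra K (SuperMatrix K p) where
  part := parity p
  isCompl := by
    constructor
    · rw [Submodule.disjoint_def]
      intro x h₀ h₁
      funext a b
      by_cases h : p a + p b = 0
      · exact h₁ a b (by simp [h])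
      · exact h₀ a b h
    · rw [codisjoint_iff, eq_top_iff]
      intro x _
      refine Submodule.mem_sup.2 ⟨fun a b => if p a + p b = 0 then x a b else 0, ?_,
        fun a b => if p a + p b = 0 then 0 else x a b, ?_, ?_⟩
      · intro a b h
        exact if_neg h
      · intro a b h
        have h2 : ∀ i : ZMod 2, i ≠ 1 → i = 0 := by decide
        exact if_pos (h2 _ h)
      · funext a b
        change (if _ then _ else _) + (if _ then _ else _) = x a b
        split_ifs <;> simp
  br := superBr
  br_mem := fun {i j x y} hx hy => by
    rw [superBr_eq hx hy]
    exact Submodule.sub_mem _ (mul_mem_parity hx hy)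
      (Submodule.smul_mem _ _ (add_comm j i ▸ mul_mem_parity hy hx))

theorem br_apply (x y : SuperMatrix K p) (a b : N) : br K x y a b =
    ∑ k, (x a k * y k b - superSign K (p a + p k) (p k + p b) * (y a k * x k b)) := rfl

theorem br_eq {i j : ZMod 2} {x y : SuperMatrix K p} (hx : x ∈ part K i) (hy : y ∈ part K j) :
    br K x y = x * y - superSign K i j • (y * x) := superBr_eq hx hy

theorem jacobi_of_mem {i j k : ZMod 2} {x y z : SuperMatrix K p} (hx : x ∈ part K i)
    (hy : y ∈ part K j) (hz : z ∈ part K k) :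
    br K x (br K y z) = br K (br K x y) z + superSign K i j • br K y (br K x z) := by
  rw [br_eq hx (br_mem hy hz), br_eq hy hz, br_eq (br_mem hx hy) hz, br_eq hx hy,
    br_eq hy (br_mem hx hz), br_eq hx hz, superSign_add_right, superSign_add_right,
    superSign_add_left, superSign_comm K j i]
  rcases superSign_eq_one_or K i j with h1 | h1 <;>
    rcases superSign_eq_one_or K i k with h2 | h2 <;>
    rcases superSign_eq_one_or K j k with h3 | h3 <;> simp only [h1, h2, h3, one_smul, neg_smul,
      mul_one, mul_neg, neg_neg] <;> noncomm_ring

instance : LieSuperalgebra K (SuperMatrix K p) where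
  skew := fun {i j x y} hx hy => by
    rw [br_eq hx hy, br_eq hy hx, smul_sub, smul_smul, superSign_comm K j i, superSign_mul_self,
      one_smul, neg_sub]
  jacobi := fun {i j x y} z hx hy => by
    obtain ⟨z₀, h₀, z₁, h₁, rfl⟩ := Superalgebra.exists_add (K := K) z
    simp only [map_add, jacobi_of_mem hx hy h₀, jacobi_of_mem hx hy h₁, smul_add]
    abel
  even_self := fun hx => by
    rw [br_eq hx hx, superSign_zero_left, one_smul, sub_self]
  odd_self := fun {x} hx => by
    rw [br_eq hx (br_mem hx hx), br_eq hx hx, superSign_add_right, superSign_mul_self, one_smul]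
    simp only [mul_sub, sub_mul, mul_smul_comm, smul_mul_assoc, mul_assoc, sub_self]

end SuperMatrix

/-! ### The universal property of the free Lie superalgebra -/

section Free

variable {K : Type*} [Field K] {X : Type*}

/-- The value of a non-associative monomial in a superalgebra `M` when the letters are evaluated
through `g`. -/
def evalMonomial {M : Type*} [AddCommGroup M] [Module K M] [Superalgebra K M] (g : X → M) :
    FreeMagma X → M
  | .of x => g x
  | .mul u v => br K (evalMonomial g u) (evalMonomial g v)

variable (deg : X → ZMod 2)

theorem evalMonomial_mem {M : Type*} [AddCommGroup M] [Module K M] [Superalgebra K M]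
    {g : X → M} (hg : ∀ x, g x ∈ part K (deg x)) (w : FreeMagma X) :
    evalMonomial (K := K) g w ∈ part K (monomialDegree deg w) := by
  induction w with
  | ih1 x => exact hg x
  | ih2 u v hu hv => exact br_mem hu hv

variable (K) in
theorem monomial_mul (u v : FreeMagma X) :
    monomial K deg (u * v) = br K (monomial K deg u) (monomial K deg v) :=
  (by rw [MonoidAlgebra.single_mul_single, one_mul] :
    (MonoidAlgebra.single (u * v) 1 : FreeNonUnitalNonAssocAlgebra K X) =
      MonoidAlgebra.single u 1 * MonoidAlgebra.single v 1)

variable (K) in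
/-- The monomials are a basis of the free non-associative algebra. -/
def monomialBasis : Module.Basis (FreeMagma X) K (FreeNonassoc K deg) :=
  MonoidAlgebra.basis (FreeMagma X) K

theorem monomialBasis_apply (w : FreeMagma X) : monomialBasis K deg w = monomial K deg w :=
  MonoidAlgebra.basis_apply K w

/-- The evaluation of non-associative polynomials in a superalgebra. -/
def evalLin {M : Type*} [AddCommGroup M] [Module K M] [Superalgebra K M] (g : X → M) :
    FreeNonassoc K deg →ₗ[K] M :=
  (monomialBasis K deg).constr K (evalMonomial (K := K) g)

theorem evalLin_monomial {M : Type*} [AddCommGroup M] [Module K M] [Superalgebra K M] (g : X → M)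
    (w : FreeMagma X) : evalLin deg g (monomial K deg w) = evalMonomial (K := K) g w := by
  rw [← monomialBasis_apply]
  exact Module.Basis.constr_basis _ _ _ _

theorem evalLin_br {M : Type*} [AddCommGroup M] [Module K M] [Superalgebra K M] (g : X → M)
    (x y : FreeNonassoc K deg) :
    evalLin deg g (br K x y) = br K (evalLin deg g x) (evalLin deg g y) := by
  have h : (br K).compr₂ (evalLin deg g) =
      (br K).compl₁₂ (evalLin (K := K) deg g) (evalLin deg g) := by
    refine (monomialBasis K deg).ext fun u => (monomialBasis K deg).ext fun v => ?_
    simp only [LinearMap.compr₂_apply, LinearMap.compl₁₂_apply, monomialBasis_apply,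
      ← monomial_mul, evalLin_monomial]
    rfl
  exact LinearMap.congr_fun₂ h x y

theorem evalLin_mem {M : Type*} [AddCommGroup M] [Module K M] [Superalgebra K M] {g : X → M}
    (hg : ∀ x, g x ∈ part K (deg x)) {i : ZMod 2} {x : FreeNonassoc K deg}
    (hx : x ∈ part K i) : evalLin deg g x ∈ part K i := by
  have h : monomialSpan K deg {w | monomialDegree deg w = i} ≤
      (part K i).comap (evalLin deg g) := by
    rw [monomialSpan, Submodule.span_le]
    rintro _ ⟨w, rfl, rfl⟩
    change evalLin deg g (monomial K deg w) ∈ part K _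
    rw [evalLin_monomial]
    exact evalMonomial_mem deg hg w
  exact h hx

theorem relatorIdeal_le_ker {M : Type*} [AddCommGroup M] [Module K M] [Superalgebra K M]
    [LieSuperalgebra K M] {g : X → M} (hg : ∀ x, g x ∈ part K (deg x)) :
    (relatorIdeal K (FreeNonassoc K deg)).sub ≤ LinearMap.ker (evalLin deg g) := by
  refine sInf_le ⟨fun x hx => ?_, fun a x hx => ?_⟩
  · rw [LinearMap.mem_ker]
    cases hx with
    | skew i j x y hx hy =>
      rw [map_add, map_smul, evalLin_br, evalLin_br,
        LieSuperalgebra.skew (evalLin_mem deg hg hx) (evalLin_mem deg hg hy), neg_add_cancel]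
    | jacobi i j k x y z hx hy hz =>
      simp only [map_sub, map_smul, evalLin_br]
      rw [LieSuperalgebra.jacobi _ (evalLin_mem deg hg hx) (evalLin_mem deg hg hy), sub_sub,
        sub_self]
    | even_self x hx =>
      rw [evalLin_br, LieSuperalgebra.even_self (evalLin_mem deg hg hx)]
    | odd_self x hx =>
      rw [evalLin_br, evalLin_br, LieSuperalgebra.odd_self (evalLin_mem deg hg hx)]
  · rw [LinearMap.mem_ker] at hx
    simp only [LinearMap.mem_ker, evalLin_br, hx, map_zero, LinearMap.zero_apply, and_self]

variable (K) in
/-- The image of a letter in the free Lie superalgebra. -/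
def freeGen (x : X) : FreeLieSuper K deg :=
  (relatorIdeal K (FreeNonassoc K deg)).sub.mkQ (monomial K deg (.of x))

theorem freeGen_mem (x : X) : freeGen K deg x ∈ part K (deg x) :=
  ⟨_, Submodule.subset_span ⟨_, rfl, rfl⟩, rfl⟩

theorem mkQ_monomial (w : FreeMagma X) :
    (relatorIdeal K (FreeNonassoc K deg)).sub.mkQ (monomial K deg w) =
      evalMonomial (K := K) (freeGen K deg) w := by
  induction w with
  | ih1 x => rfl
  | ih2 u v hu hv =>
    change Submodule.mkQ _ (monomial K deg (u * v)) = br K _ _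
    rw [monomial_mul, ← hu, ← hv]
    rfl

/-- The homomorphism from the free Lie superalgebra to a Lie superalgebra that extends a parity
preserving map on the letters. -/
def freeLift {M : Type*} [AddCommGroup M] [Module K M] [Superalgebra K M] [LieSuperalgebra K M]
    (g : X → M) (hg : ∀ x, g x ∈ part K (deg x)) : SuperHom K (FreeLieSuper K deg) M where
  lin := (relatorIdeal K (FreeNonassoc K deg)).sub.liftQ (evalLin deg g)
    (relatorIdeal_le_ker deg hg)
  map_part := by
    rintro i _ ⟨x, hx, rfl⟩
    exact evalLin_mem deg hg hx
  map_br := by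
    intro x y
    obtain ⟨x, rfl⟩ := Submodule.mkQ_surjective _ x
    obtain ⟨y, rfl⟩ := Submodule.mkQ_surjective _ y
    exact evalLin_br deg g x y

theorem freeLift_freeGen {M : Type*} [AddCommGroup M] [Module K M] [Superalgebra K M]
    [LieSuperalgebra K M] (g : X → M) (hg : ∀ x, g x ∈ part K (deg x)) (x : X) :
    (freeLift deg g hg).lin (freeGen K deg x) = g x :=
  evalLin_monomial deg g _

theorem span_evalMonomial_freeGen :
    Submodule.span K (Set.range (evalMonomial (K := K) (freeGen K deg))) = ⊤ := by
  have h := congrArg (Submodule.map (relatorIdeal K (FreeNonassoc K deg)).sub.mkQ)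
    (monomialBasis K deg).span_eq
  rw [Submodule.map_span, Submodule.map_top, Submodule.range_mkQ, ← Set.range_comp] at h
  rw [← h]
  congr 2
  funext w
  rw [Function.comp_apply, monomialBasis_apply, mkQ_monomial]

/-- To prove a linear property of all elements of the free Lie superalgebra, it is enough to
consider the letters and the brackets. -/
theorem free_le_of_gen_of_br (P : Submodule K (FreeLieSuper K deg))
    (hgen : ∀ x, freeGen K deg x ∈ P) (hbr : ∀ x y, br K x y ∈ P) : P = ⊤ := by
  rw [eq_top_iff, ← span_evalMonomial_freeGen, Submodule.span_le]
  rintro _ ⟨w, rfl⟩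
  cases w with
  | of x => exact hgen x
  | mul u v => exact hbr _ _

theorem lengthComponent_eq_span (d : ℕ) : lengthComponent K deg d =
    Submodule.span K (evalMonomial (K := K) (freeGen K deg) '' {w | w.length = d}) := by
  rw [lengthComponent, monomialSpan, Submodule.map_span, Set.image_image]
  simp only [mkQ_monomial]

end Free

/-! ### Coordinates with respect to a homogeneous family -/

section Homogeneous

variable {K : Type*} [Field K] {M : Type*} [AddCommGroup M] [Module K M] [Superalgebra K M]

theorem Superalgebra.eq_zero_of_mem_of_ne {i j : ZMod 2} (h : i ≠ j) {x : M}
    (hi : x ∈ (part K i : Submodule K M)) (hj : x ∈ (part K j : Submodule K M)) : x = 0 := by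
  have h2 : ∀ i j : ZMod 2, i ≠ j → (i = 0 ∧ j = 1) ∨ (i = 1 ∧ j = 0) := by decide
  rcases h2 i j h with ⟨rfl, rfl⟩ | ⟨rfl, rfl⟩
  · exact eq_zero_of_mem hi hj
  · exact eq_zero_of_mem hj hi

variable {J : Type*} [Fintype J] {h : J → M} {d : J → ZMod 2}

/-- A combination of independent homogeneous elements is homogeneous of parity `i` exactly if the
elements of the other parity do not occur in it. -/
theorem sum_mem_part_iff (hh : ∀ j, h j ∈ (part K (d j) : Submodule K M))
    (hli : LinearIndependent K h) (c : J → K) (i : ZMod 2) :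
    ∑ j, c j • h j ∈ (part K i : Submodule K M) ↔ ∀ j, d j ≠ i → c j = 0 := by
  have key : ∀ (c : J → K) (i : ZMod 2), (∀ j, d j ≠ i → c j = 0) →
      ∑ j, c j • h j ∈ (part K i : Submodule K M) := by
    intro c i hc
    refine Submodule.sum_mem _ fun j _ => ?_
    by_cases hj : d j = i
    · exact Submodule.smul_mem _ _ (hj ▸ hh j)
    · rw [hc j hj, zero_smul]
      exact Submodule.zero_mem _
  refine ⟨fun hx => ?_, key c i⟩
  have e : ∑ j, c j • h j = ∑ j, (if d j = i then c j else 0) • h j +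
      ∑ j, (if d j = i then 0 else c j) • h j := by
    rw [← Finset.sum_add_distrib]
    refine Finset.sum_congr rfl fun j _ => ?_
    split_ifs <;> simp
  have h1 := key (fun j => if d j = i then c j else 0) i fun j hj => if_neg hj
  have h2 := key (fun j => if d j = i then 0 else c j) (i + 1) fun j hj => by
    have h2 : ∀ i k : ZMod 2, k ≠ i + 1 → k = i := by decide
    exact if_pos (h2 _ _ hj)
  have h3 : ∑ j, (if d j = i then 0 else c j) • h j = 0 := by
    refine eq_zero_of_mem_of_ne (K := K) (i := i) (j := i + 1) (by simp) ?_ h2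
    rw [eq_sub_of_add_eq' e.symm]
    exact Submodule.sub_mem _ hx h1
  intro j hj
  have := Fintype.linearIndependent_iff.1 hli _ h3 j
  simpa [hj] using this

theorem rank_part_eq (hh : ∀ j, h j ∈ (part K (d j) : Submodule K M))
    (hli : LinearIndependent K h) (hspan : Submodule.span K (Set.range h) = ⊤) (i : ZMod 2) :
    Module.rank K (part K i : Submodule K M) = (Fintype.card {j // d j = i} : ℕ) := by
  have e : (part K i : Submodule K M) =
      Submodule.span K (Set.range fun j : {j // d j = i} => h j) := by
    apply le_antisymm
    · intro x hx
      have hx' : x ∈ Submodule.span K (Set.range h) := hspan ▸ trivial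
      obtain ⟨c, rfl⟩ := (Submodule.mem_span_range_iff_exists_fun K).1 hx'
      rw [sum_mem_part_iff hh hli] at hx
      refine Submodule.sum_mem _ fun j _ => ?_
      by_cases hj : d j = i
      · exact Submodule.smul_mem _ _ (Submodule.subset_span ⟨⟨j, hj⟩, rfl⟩)
      · rw [hx j hj, zero_smul]
        exact Submodule.zero_mem _
    · rw [Submodule.span_le]
      rintro _ ⟨⟨j, rfl⟩, rfl⟩
      exact hh j
  have hli' : LinearIndependent K fun j : {j // d j = i} => h j :=
    hli.comp _ Subtype.val_injective
  rw [e]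
  exact rank_eq_card_basis (Module.Basis.span hli')

theorem HasSuperdim.exists_basis {m n : ℕ} (hdim : HasSuperdim K M m n) :
    ∃ b : Module.Basis (Fin m ⊕ Fin n) K M,
      ∀ l, b l ∈ (part K (stdDegree m n l) : Submodule K M) := by
  have hf0 : Module.Finite K (part K 0 : Submodule K M) :=
    Module.finite_of_rank_eq_nat hdim.1
  have hf1 : Module.Finite K (part K 1 : Submodule K M) :=
    Module.finite_of_rank_eq_nat hdim.2
  let b0 := Module.finBasisOfFinrankEq K (part K 0 : Submodule K M)
    (Module.finrank_eq_of_rank_eq hdim.1)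
  let b1 := Module.finBasisOfFinrankEq K (part K 1 : Submodule K M)
    (Module.finrank_eq_of_rank_eq hdim.2)
  refine ⟨(b0.prod b1).map (Submodule.prodEquivOfIsCompl _ _ isCompl), ?_⟩
  rintro (l | l)
  · simp [stdDegree]
  · simp [stdDegree]

end Homogeneous

/-! ### Triple brackets in a Lie superalgebra -/

section Triple

variable {K : Type*} [Field K] {M : Type*} [AddCommGroup M] [Module K M] [Superalgebra K M]
  [LieSuperalgebra K M]

theorem br_br_mem_of_swap {H : Submodule K M} {i j : ZMod 2} {x y : M} (z : M)
    (hx : x ∈ part K i) (hy : y ∈ part K j) (h : br K (br K y x) z ∈ H) :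
    br K (br K x y) z ∈ H := by
  rw [LieSuperalgebra.skew hx hy]
  simpa using H.smul_mem _ h

theorem br_mem_of_swap {H : Submodule K M} {i j : ZMod 2} {x y : M}
    (hx : x ∈ part K i) (hy : y ∈ part K j) (h : br K y x ∈ H) : br K x y ∈ H := by
  rw [LieSuperalgebra.skew hx hy]
  simpa using H.smul_mem _ h

theorem br_br_mem_of_jacobi {H : Submodule K M} {i j k : ZMod 2} {x y z : M}
    (hx : x ∈ part K i) (hy : y ∈ part K j) (hz : z ∈ part K k)
    (h₁ : br K (br K y z) x ∈ H) (h₂ : br K (br K x z) y ∈ H) :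
    br K (br K x y) z ∈ H := by
  rw [eq_sub_of_add_eq (LieSuperalgebra.jacobi (K := K) z hx hy).symm]
  exact H.sub_mem (br_mem_of_swap hx (br_mem hy hz) h₁)
    (H.smul_mem _ (br_mem_of_swap hy (br_mem hx hz) h₂))

/-- The triples `(b, c, a)` with `b < c` and `b ≤ a`; the brackets `[[b, c], a]` are the basic
commutators of weight `3` in the letters `ι`. -/
abbrev HallTriple (ι : Type*) [LinearOrder ι] : Type _ :=
  {t : ι × ι × ι // t.1 < t.2.1 ∧ t.1 ≤ t.2.2}

variable {ι : Type*} [LinearOrder ι]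

/-- The parity of a triple of letters. -/
def tripleParity (d : ι → ZMod 2) (t : ι × ι × ι) : ZMod 2 := d t.1 + d t.2.1 + d t.2.2

variable (K) in
/-- The bracket `[[e b, e c], e a]` of a triple `(b, c, a)`. -/
def tripleBr (e : ι → M) (t : ι × ι × ι) : M := br K (br K (e t.1) (e t.2.1)) (e t.2.2)

omit [LieSuperalgebra K M] [LinearOrder ι] in
theorem tripleBr_mem {e : ι → M} {d : ι → ZMod 2} (he : ∀ l, e l ∈ part K (d l))
    (t : ι × ι × ι) : tripleBr K e t ∈ part K (tripleParity d t) :=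
  br_mem (br_mem (he _) (he _)) (he _)

/-- Triple brackets of homogeneous elements are combinations of the basic ones. This uses all
the axioms of a Lie superalgebra. -/
theorem br_br_mem_span_hall {e : ι → M} {d : ι → ZMod 2} (he : ∀ l, e l ∈ part K (d l))
    (x y z : ι) : br K (br K (e x) (e y)) (e z) ∈
      Submodule.span K (Set.range fun t : HallTriple ι => tripleBr K e t) := by
  set H := Submodule.span K (Set.range fun t : HallTriple ι => tripleBr K e t) with hH
  have basic : ∀ {b c a : ι}, b < c → b ≤ a → br K (br K (e b) (e c)) (e a) ∈ H :=
    fun {b c a} h₁ h₂ => Submodule.subset_span ⟨⟨(b, c, a), h₁, h₂⟩, rfl⟩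
  have lt : ∀ {b c : ι} (a : ι), b < c → br K (br K (e b) (e c)) (e a) ∈ H := by
    intro b c a h
    rcases le_or_gt b a with hba | hab
    · exact basic h hba
    · refine br_br_mem_of_jacobi (he b) (he c) (he a) ?_ ?_
      · exact br_br_mem_of_swap _ (he c) (he a) (basic (hab.trans h) hab.le)
      · exact br_br_mem_of_swap _ (he b) (he a) (basic hab (hab.trans h).le)
  have ne : ∀ {b c : ι} (a : ι), b ≠ c → br K (br K (e b) (e c)) (e a) ∈ H := by
    intro b c a h
    rcases lt_or_gt_of_ne h with h | h
    · exact lt a h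
    · exact br_br_mem_of_swap _ (he b) (he c) (lt a h)
  rcases eq_or_ne x y with rfl | hxy
  · rcases eq_or_ne x z with rfl | hxz
    · have h2 : ∀ i : ZMod 2, i = 0 ∨ i = 1 := by decide
      have hx := he x
      rcases h2 (d x) with h0 | h0 <;> rw [h0] at hx
      · rw [LieSuperalgebra.even_self hx, map_zero, LinearMap.zero_apply]
        exact H.zero_mem
      · refine br_mem_of_swap (br_mem hx hx) hx ?_
        rw [LieSuperalgebra.odd_self hx]
        exact H.zero_mem
    · exact br_br_mem_of_jacobi (he x) (he x) (he z) (ne x hxz) (ne x hxz)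
  · exact ne z hxy

end Triple

/-! ### Counting the basic triples -/

section Count

variable {ι : Type*} [LinearOrder ι]

/-- Every triple is either constant or has exactly one cyclic rotation that is a Hall triple. -/
theorem hall_rotations (x y z : ι) :
    (if x < y ∧ x ≤ z then 1 else 0) + (if y < z ∧ y ≤ x then 1 else 0) +
      (if z < x ∧ z ≤ y then 1 else 0) + (if x = y ∧ y = z then 1 else 0) = 1 := by
  rcases lt_trichotomy x y with h | h | h <;> rcases lt_trichotomy y z with h' | h' | h' <;>
    rcases lt_trichotomy x z with h'' | h'' | h'' <;> grind

theorem three_mul_card_hall [Fintype ι] (d : ι → ZMod 2) (i : ZMod 2) :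
    3 * Fintype.card {t : HallTriple ι // tripleParity d t = i} + Fintype.card {l // d l = i} =
      ∑ x, ∑ y, ∑ z, if d x + d y + d z = i then 1 else 0 := by
  have hcard : Fintype.card {t : HallTriple ι // tripleParity d t = i} =
      ∑ x, ∑ y, ∑ z, if d x + d y + d z = i then (if x < y ∧ x ≤ z then 1 else 0) else 0 := by
    rw [Fintype.card_congr (Equiv.subtypeSubtypeEquivSubtypeInter
      (fun t : ι × ι × ι => t.1 < t.2.1 ∧ t.1 ≤ t.2.2) (fun t => tripleParity d t = i)),
      Fintype.card_subtype, Finset.card_filter, Fintype.sum_prod_type]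
    refine Finset.sum_congr rfl fun x _ => ?_
    rw [Fintype.sum_prod_type]
    refine Finset.sum_congr rfl fun y _ => Finset.sum_congr rfl fun z _ => ?_
    rw [← ite_and]
    exact if_congr and_comm rfl rfl
  have hdiag : Fintype.card {l // d l = i} =
      ∑ x, ∑ y, ∑ z, if d x + d y + d z = i then (if x = y ∧ y = z then 1 else 0) else 0 := by
    have h3 : ∀ i : ZMod 2, i + i + i = i := by decide
    rw [Fintype.card_subtype, Finset.card_filter]
    refine Finset.sum_congr rfl fun x _ => ?_
    rw [Fintype.sum_eq_single x, Fintype.sum_eq_single x]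
    · simp [h3]
    · intro z hz
      simp [hz.symm]
    · intro y hy
      simp [hy.symm]
  -- The two other rotations of a triple have the same parity as the triple.
  have hrot₁ : (∑ x, ∑ y, ∑ z, if d x + d y + d z = i then (if x < y ∧ x ≤ z then 1 else 0) else 0)
      = ∑ x, ∑ y, ∑ z, if d x + d y + d z = i then (if y < z ∧ y ≤ x then 1 else 0) else 0 := by
    conv_rhs => rw [Finset.sum_comm]; enter [2, x]; rw [Finset.sum_comm]
    refine Finset.sum_congr rfl fun x _ => Finset.sum_congr rfl fun y _ =>
      Finset.sum_congr rfl fun z _ => ?_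
    rw [show d z + d x + d y = d x + d y + d z by ring]
  have hrot₂ : (∑ x, ∑ y, ∑ z, if d x + d y + d z = i then (if x < y ∧ x ≤ z then 1 else 0) else 0)
      = ∑ x, ∑ y, ∑ z, if d x + d y + d z = i then (if z < x ∧ z ≤ y then 1 else 0) else 0 := by
    conv_lhs => rw [Finset.sum_comm]; enter [2, x]; rw [Finset.sum_comm]
    refine Finset.sum_congr rfl fun x _ => Finset.sum_congr rfl fun y _ =>
      Finset.sum_congr rfl fun z _ => ?_
    rw [show d z + d x + d y = d x + d y + d z by ring]
  have hsum : ∀ {k a b c : ℕ}, k = a → k = b → k = c → 3 * k = a + b + c := by omega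
  rw [hdiag, hsum hcard (hcard.trans hrot₁) (hcard.trans hrot₂)]
  simp only [← Finset.sum_add_distrib]
  refine Finset.sum_congr rfl fun x _ => Finset.sum_congr rfl fun y _ =>
    Finset.sum_congr rfl fun z _ => ?_
  by_cases h : d x + d y + d z = i
  · simp only [if_pos h]
    exact hall_rotations x y z
  · simp only [if_neg h, add_zero]

/-- The alphabet with `m` even and `n` odd letters, ordered with the even letters first. -/
abbrev Letters (m n : ℕ) : Type := Fin m ⊕ₗ Fin n

/-- The parity of a letter. -/
def letterParity (m n : ℕ) (l : Letters m n) : ZMod 2 := stdDegree m n (ofLex l)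

theorem card_hall_even (m n : ℕ) :
    (Fintype.card {t : HallTriple (Letters m n) // tripleParity (letterParity m n) t = 0} : ℚ) =
      (1 / 3) * ((m : ℚ) ^ 3 + 3 * (n : ℚ) ^ 2 * m - m) := by
  have h := three_mul_card_hall (letterParity m n) 0
  have h11 : (1 + 1 : ZMod 2) = 0 := by decide
  have h1 : Fintype.card {l : Letters m n // letterParity m n l = 0} = m := by
    rw [Fintype.card_subtype, Finset.card_filter, ← toLex.sum_comp, Fintype.sum_sum_type]
    simp [letterParity, stdDegree]
  rw [h1] at h
  simp only [← (toLex (α := Fin m ⊕ Fin n)).sum_comp, Fintype.sum_sum_type] at h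
  simp [letterParity, stdDegree, h11] at h
  have h' := congrArg (Nat.cast (R := ℚ)) h
  push_cast at h'
  linarith

theorem card_hall_odd (m n : ℕ) :
    (Fintype.card {t : HallTriple (Letters m n) // tripleParity (letterParity m n) t = 1} : ℚ) =
      (1 / 3) * (3 * (m : ℚ) ^ 2 * n + (n : ℚ) ^ 3 - n) := by
  have h := three_mul_card_hall (letterParity m n) 1
  have h11 : (1 + 1 : ZMod 2) = 0 := by decide
  have h1 : Fintype.card {l : Letters m n // letterParity m n l = 1} = n := by
    rw [Fintype.card_subtype, Finset.card_filter, ← toLex.sum_comp, Fintype.sum_sum_type]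
    simp [letterParity, stdDegree]
  rw [h1] at h
  simp only [← (toLex (α := Fin m ⊕ Fin n)).sum_comp, Fintype.sum_sum_type] at h
  simp [letterParity, stdDegree, h11] at h
  have h' := congrArg (Nat.cast (R := ℚ)) h
  push_cast at h'
  linarith

end Count

/-! ### Lower central series -/

section Central

variable {K : Type*} [Field K] {F : Type*} [AddCommGroup F] [Module K F] [Superalgebra K F]
  [LieSuperalgebra K F]

namespace GradedIdeal

theorem br_mem_bracketTop (I : GradedIdeal K F) {x : F} (hx : x ∈ I.sub) (a : F) :
    br K x a ∈ I.bracketTop.sub :=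
  Submodule.apply_mem_map₂ _ hx trivial

theorem br_mem_bracketTop' (I : GradedIdeal K F) {x : F} (hx : x ∈ I.sub) (a : F) :
    br K a x ∈ I.bracketTop.sub := by
  obtain ⟨x₀, k₀, x₁, k₁, h₀, h₁, rfl⟩ := I.graded.exists_add hx
  obtain ⟨a₀, l₀, a₁, l₁, rfl⟩ := Superalgebra.exists_add (K := K) a
  simp only [map_add, LinearMap.add_apply]
  exact Submodule.add_mem _
    (Submodule.add_mem _ (br_mem_of_swap l₀ k₀ (I.br_mem_bracketTop h₀ _))
      (br_mem_of_swap l₁ k₀ (I.br_mem_bracketTop h₀ _)))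
    (Submodule.add_mem _ (br_mem_of_swap l₀ k₁ (I.br_mem_bracketTop h₁ _))
      (br_mem_of_swap l₁ k₁ (I.br_mem_bracketTop h₁ _)))

theorem br_br_mem_gamma_two (I : GradedIdeal K F) {x : F} (hx : x ∈ I.sub) (a b : F) :
    br K (br K a b) x ∈ (I.gamma 2).sub := by
  obtain ⟨a₀, l₀, a₁, l₁, rfl⟩ := Superalgebra.exists_add (K := K) a
  obtain ⟨b₀, k₀, b₁, k₁, rfl⟩ := Superalgebra.exists_add (K := K) b
  have key : ∀ {i j : ZMod 2} {a b : F}, a ∈ part K i → b ∈ part K j →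
      br K (br K a b) x ∈ (I.gamma 2).sub := by
    intro i j a b ha hb
    rw [eq_sub_of_add_eq (LieSuperalgebra.jacobi (K := K) x ha hb).symm]
    exact Submodule.sub_mem _
      ((I.gamma 1).br_mem_bracketTop' (I.br_mem_bracketTop' hx b) a)
      (Submodule.smul_mem _ _ ((I.gamma 1).br_mem_bracketTop' (I.br_mem_bracketTop' hx a) b))
  simp only [map_add, LinearMap.add_apply]
  exact Submodule.add_mem _ (Submodule.add_mem _ (key l₀ k₀) (key l₁ k₀))
    (Submodule.add_mem _ (key l₀ k₁) (key l₁ k₁))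

theorem bracketTop_mono {I J : GradedIdeal K F} (h : I.sub ≤ J.sub) :
    I.bracketTop.sub ≤ J.bracketTop.sub :=
  Submodule.map₂_le_map₂_left h

/-- If the quotient by `I` is abelian, then the lower central series of the algebra is below the
one of `I`, with a shift by one. -/
theorem top_gamma_succ_le (I : GradedIdeal K F) (h : (top.gamma 1 : GradedIdeal K F).sub ≤ I.sub)
    (k : ℕ) : (top.gamma (k + 1) : GradedIdeal K F).sub ≤ (I.gamma k).sub := by
  induction k with
  | zero => exact h
  | succ k ih => exact bracketTop_mono ih

theorem tripleBr_mem_gamma {ι : Type*} (e : ι → F) (t : ι × ι × ι) :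
    tripleBr K e t ∈ (top.gamma 2 : GradedIdeal K F).sub :=
  (top.gamma 1).br_mem_bracketTop (top.br_mem_bracketTop (Submodule.mem_top (x := e t.1)) _) _

/-- If an ideal `I` and homogeneous elements `e l` span the algebra, then the basic triple
brackets of the `e l` span `γ₃` modulo `γ₃(I)`. -/
theorem gamma_two_le_span_hall {ι : Type*} [LinearOrder ι] (I : GradedIdeal K F) {e : ι → F}
    {d : ι → ZMod 2} (he : ∀ l, e l ∈ part K (d l))
    (hspan : ∀ x : F, ∃ y ∈ Submodule.span K (Set.range e), x - y ∈ I.sub) :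
    (top.gamma 2 : GradedIdeal K F).sub ≤
      Submodule.span K (Set.range fun t : HallTriple ι => tripleBr K e t) ⊔ (I.gamma 2).sub := by
  set H := Submodule.span K (Set.range fun t : HallTriple ι => tripleBr K e t)
  have hE : ∀ x ∈ Submodule.span K (Set.range e), ∀ y ∈ Submodule.span K (Set.range e),
      ∀ z ∈ Submodule.span K (Set.range e), br K (br K x y) z ∈ H := by
    intro x hx y hy z hz
    have h := Submodule.apply_mem_map₂ (br K) (Submodule.apply_mem_map₂ (br K) hx hy) hz
    rw [Submodule.map₂_span_span, Submodule.map₂_span_span] at h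
    refine Submodule.span_le.2 ?_ h
    rintro _ ⟨_, ⟨_, ⟨a, rfl⟩, _, ⟨b, rfl⟩, rfl⟩, _, ⟨c, rfl⟩, rfl⟩
    exact br_br_mem_span_hall he a b c
  have key : ∀ x y z : F, br K (br K x y) z ∈ H ⊔ (I.gamma 2).sub := by
    intro x y z
    obtain ⟨x', hx', hx⟩ := hspan x
    obtain ⟨y', hy', hy⟩ := hspan y
    obtain ⟨z', hz', hz⟩ := hspan z
    have e1 : br K (br K x y) z = br K (br K x' y') z' + (br K (br K (x - x') y) z +
        br K (br K x' (y - y')) z + br K (br K x' y') (z - z')) := by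
      simp only [map_sub, LinearMap.sub_apply]
      abel
    rw [e1]
    exact Submodule.add_mem_sup (hE x' hx' y' hy' z' hz') (Submodule.add_mem _
      (Submodule.add_mem _
        (br_mem_bracketTop _ (br_mem_bracketTop _ hx y) z)
        (br_mem_bracketTop _ (br_mem_bracketTop' _ hy x') z))
      (br_br_mem_gamma_two _ hz x' y'))
  refine Submodule.map₂_le.2 fun u hu z _ => ?_
  have : (top.gamma 1 : GradedIdeal K F).sub ≤
      (H ⊔ (I.gamma 2).sub).comap ((br K).flip z) :=
    Submodule.map₂_le.2 fun x _ y _ => key x y z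
  exact this hu

end GradedIdeal
end Central

/-! ### Strictly upper triangular supermatrices and words of length three -/

namespace SuperMatrix

variable {K : Type*} [Field K] {n : ℕ} {p : Fin n → ZMod 2}

/-- The matrices that are supported on or above the `k`-th diagonal above the main one. -/
def upper (p : Fin n → ZMod 2) (k : ℕ) : Submodule K (SuperMatrix K p) where
  carrier := {M | ∀ a b : Fin n, (b : ℕ) < a + k → M a b = 0}
  add_mem' := fun {x y} hx hy a b h => by
    change x a b + y a b = 0
    rw [hx a b h, hy a b h, add_zero]
  zero_mem' := fun _ _ _ => rfl
  smul_mem' := fun c x hx a b h => by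
    change c * x a b = 0
    rw [hx a b h, mul_zero]

theorem br_mem_upper {k l : ℕ} {x y : SuperMatrix K p} (hx : x ∈ upper p k) (hy : y ∈ upper p l) :
    br K x y ∈ upper p (k + l) := by
  intro a b h
  rw [br_apply]
  refine Finset.sum_eq_zero fun c _ => ?_
  have h1 : x a c * y c b = 0 := by
    rcases lt_or_ge (c : ℕ) (a + k) with hc | hc
    · rw [hx a c hc, zero_mul]
    · rw [hy c b (by omega), mul_zero]
  have h2 : y a c * x c b = 0 := by
    rcases lt_or_ge (c : ℕ) (a + l) with hc | hc
    · rw [hy a c hc, zero_mul]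
    · rw [hx c b (by omega), mul_zero]
  rw [h1, h2, mul_zero, sub_zero]

theorem upper_anti {k l : ℕ} (h : k ≤ l) :
    (upper p l : Submodule K (SuperMatrix K p)) ≤ upper p k :=
  fun _ hx a b hab => hx a b (by omega)

/-- The corner entry of a triple bracket of strictly upper triangular `4 × 4` matrices depends on
the superdiagonals only. -/
theorem br_br_corner {p : Fin 4 → ZMod 2} {x y z : SuperMatrix K p} (hx : x ∈ upper p 1)
    (hy : y ∈ upper p 1) (hz : z ∈ upper p 1) :
    br K (br K x y) z 0 3 =
      (x 0 1 * y 1 2 - superSign K (p 0 + p 1) (p 1 + p 2) * (y 0 1 * x 1 2)) * z 2 3 -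
      superSign K (p 0 + p 1) (p 1 + p 3) * (z 0 1 *
        (x 1 2 * y 2 3 - superSign K (p 1 + p 2) (p 2 + p 3) * (y 1 2 * x 2 3))) := by
  have h := fun {x : SuperMatrix K p} (hx : x ∈ upper p 1) (a b : Fin 4) (hab : b ≤ a) =>
    hx a b (Nat.lt_succ_of_le hab)
  have hxy := br_mem_upper hx hy
  rw [br_apply, Fin.sum_univ_four, h hz 3 3 le_rfl, h hz 0 0 le_rfl, hxy 0 0 (by decide),
    hxy 0 1 (by decide), hxy 2 3 (by decide), hxy 3 3 (by decide), br_apply x y 0 2,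
    br_apply x y 1 3, Fin.sum_univ_four, Fin.sum_univ_four, h hx 0 0 le_rfl, h hx 2 2 le_rfl,
    h hy 0 0 le_rfl, h hy 2 2 le_rfl, h hx 1 0 (by decide), h hy 1 0 (by decide),
    h hx 3 2 (by decide), h hx 1 1 le_rfl, h hy 1 1 le_rfl, h hx 3 3 le_rfl,
    h hy 3 3 le_rfl, h hy 3 2 (by decide)]
  ring

end SuperMatrix

section Word

variable {K : Type*} [Field K] {ι : Type*}

/-- The parities of the four indices for which the `i`-th superdiagonal entry has the parity of
the `i`-th letter of the word `w`. -/
def wordParity (d : ι → ZMod 2) (w : ι × ι × ι) : Fin 4 → ZMod 2 :=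
  ![0, d w.1, d w.1 + d w.2.1, d w.1 + d w.2.1 + d w.2.2]

variable (K) in
/-- The letter `l` acts by the superdiagonal matrix whose `i`-th entry is `1` if `l` is the `i`-th
letter of `w`, and by `0` elsewhere; this is its extension to combinations of letters. The corner
entry then reads off the coefficient of `w` in degree `3`. -/
def wordMatrix (d : ι → ZMod 2) (w : ι × ι × ι) :
    (ι → K) →ₗ[K] SuperMatrix K (wordParity d w) where
  toFun u := !![0, u w.1, 0, 0; 0, 0, u w.2.1, 0; 0, 0, 0, u w.2.2; 0, 0, 0, 0]
  map_add' u v := by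
    funext a b
    change _ = (_ : K) + _
    fin_cases a <;> fin_cases b <;> simp
  map_smul' c u := by
    funext a b
    change _ = c * (_ : K)
    fin_cases a <;> fin_cases b <;> simp

theorem wordMatrix_mem_upper (d : ι → ZMod 2) (w : ι × ι × ι) (u : ι → K) :
    wordMatrix K d w u ∈ SuperMatrix.upper (wordParity d w) 1 := by
  intro a b h
  fin_cases a <;> fin_cases b <;> first | rfl | (exfalso; revert h; decide)

theorem wordMatrix_mem_part {d : ι → ZMod 2} (w : ι × ι × ι) {u : ι → K} {i : ZMod 2}
    (hu : ∀ l, d l ≠ i → u l = 0) : wordMatrix K d w u ∈ part K i := by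
  intro a b h
  have h2 : ∀ x y : ZMod 2, x + (x + y) = y := by decide
  fin_cases a <;> fin_cases b <;> first | rfl | skip
  · exact hu _ fun h' => h (by simpa [wordParity] using h')
  · exact hu _ fun h' => h (by simpa [wordParity, h2] using h')
  · exact hu _ fun h' => h (by simpa [wordParity, h2] using h')

variable [LinearOrder ι]

/-- A word that occurs in the expansion of the basic bracket `[[b, c], a]` of the triple
`t = (b, c, a)` in the free associative algebra with coefficient `±1`, and in the expansion of no
other basic bracket. -/
def dualWord (t : ι × ι × ι) : ι × ι × ι := if t.1 = t.2.2 then (t.1, t.1, t.2.1) else t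

/-- The signed sum of the four words of `[[b, c], a]` is dual to `dualWord`. -/
theorem dualWord_pairing (t t' : HallTriple ι) (r s q : K) :
    let w := dualWord t.1
    let u := Pi.single (M := fun _ : ι => K) t'.1.1 1
    let v := Pi.single (M := fun _ : ι => K) t'.1.2.1 1
    let x := Pi.single (M := fun _ : ι => K) t'.1.2.2 1
    (u w.1 * v w.2.1 - r * (v w.1 * u w.2.1)) * x w.2.2 -
      s * (x w.1 * (u w.2.1 * v w.2.2 - q * (v w.2.1 * u w.2.2))) =
    if t' = t then (if t.1.1 = t.1.2.2 then -s else 1) else 0 := by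
  intro w u v x
  obtain ⟨⟨b, c, a⟩, hbc, hba⟩ := t
  obtain ⟨⟨b', c', a'⟩, hbc', hba'⟩ := t'
  have key : ∀ l₁ l₂ l₃ : ι, Pi.single (M := fun _ : ι => K) l₁ 1 w.1 *
      Pi.single (M := fun _ : ι => K) l₂ 1 w.2.1 * Pi.single (M := fun _ : ι => K) l₃ 1 w.2.2 =
      if w = (l₁, l₂, l₃) then 1 else 0 := by
    intro l₁ l₂ l₃
    simp only [Pi.single_apply, Prod.ext_iff, ← ite_and, mul_ite, mul_one, mul_zero]
    exact if_congr (by tauto) rfl rfl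
  have e₁ : w = (b', c', a') ↔ (b', c', a') = (b, c, a) ∧ b ≠ a := by
    simp only [w, dualWord] at *
    split_ifs <;> grind
  have e₂ : w ≠ (c', b', a') := by
    simp only [w, dualWord] at *
    split_ifs <;> grind
  have e₃ : w = (a', b', c') ↔ (b', c', a') = (b, c, a) ∧ b = a := by
    simp only [w, dualWord] at *
    split_ifs <;> grind
  have e₄ : w ≠ (a', c', b') := by
    simp only [w, dualWord] at *
    split_ifs <;> grind
  have k₁ := key b' c' a'
  have k₂ := key c' b' a'
  have k₃ := key a' b' c'
  have k₄ := key a' c' b'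
  rw [if_neg e₂] at k₂
  rw [if_neg e₄] at k₄
  rw [if_congr e₁ rfl rfl] at k₁
  rw [if_congr e₃ rfl rfl] at k₃
  simp only [Subtype.mk.injEq]
  calc _ = (u w.1 * v w.2.1 * x w.2.2) - r * (v w.1 * u w.2.1 * x w.2.2) -
      s * (x w.1 * u w.2.1 * v w.2.2) + s * q * (x w.1 * v w.2.1 * u w.2.2) := by ring
    _ = _ := by
      rw [k₁, k₂, k₃, k₄]
      split_ifs <;> first | (exfalso; tauto) | ring

end Word

/-! ### Presentations of an abelian Lie superalgebra -/

section Presentation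

variable {K : Type*} [Field K] {X : Type*} {deg : X → ZMod 2} {L : Type*} [AddCommGroup L]
  [Module K L] [Superalgebra K L] {ι : Type*} [Fintype ι] {d : ι → ZMod 2}

theorem basis_coord_eq_zero {b : Module.Basis ι K L}
    (hb : ∀ l, b l ∈ (part K (d l) : Submodule K L))
    {i : ZMod 2} {v : L} (hv : v ∈ (part K i : Submodule K L)) (l : ι) (hl : d l ≠ i) :
    b.equivFun v l = 0 := by
  rw [← b.sum_equivFun v, sum_mem_part_iff hb b.linearIndependent] at hv
  exact hv l hl

/-- The representation of the free Lie superalgebra by strictly upper triangular matrices that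
lets each letter `x` act through the coordinates of `π x` and the word `w`. -/
def wordRep (π : SuperHom K (FreeLieSuper K deg) L) {b : Module.Basis ι K L}
    (hb : ∀ l, b l ∈ (part K (d l) : Submodule K L)) (w : ι × ι × ι) :
    SuperHom K (FreeLieSuper K deg) (SuperMatrix K (wordParity d w)) :=
  freeLift deg (fun x => wordMatrix K d w (b.equivFun (π.lin (freeGen K deg x)))) fun x =>
    wordMatrix_mem_part w (basis_coord_eq_zero hb (π.map_part (freeGen_mem deg x)))

variable {π : SuperHom K (FreeLieSuper K deg) L} {b : Module.Basis ι K L}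
  (hb : ∀ l, b l ∈ (part K (d l) : Submodule K L)) (w : ι × ι × ι)

theorem wordRep_mem_upper_one (f : FreeLieSuper K deg) :
    (wordRep π hb w).lin f ∈ SuperMatrix.upper (wordParity d w) 1 := by
  have h : (SuperMatrix.upper (wordParity d w) 1).comap (wordRep π hb w).lin = ⊤ := by
    rw [eq_top_iff, ← span_evalMonomial_freeGen, Submodule.span_le]
    rintro _ ⟨u, rfl⟩
    change (wordRep π hb w).lin (evalMonomial (K := K) (freeGen K deg) u) ∈
      SuperMatrix.upper (wordParity d w) 1
    induction u with
    | ih1 x =>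
      change (wordRep π hb w).lin (freeGen K deg x) ∈ SuperMatrix.upper (wordParity d w) 1
      rw [wordRep, freeLift_freeGen]
      exact wordMatrix_mem_upper _ _ _
    | ih2 u v hu hv =>
      change (wordRep π hb w).lin (br K _ _) ∈ SuperMatrix.upper (wordParity d w) 1
      rw [SuperHom.map_br]
      exact SuperMatrix.upper_anti (by norm_num) (SuperMatrix.br_mem_upper hu hv)
  have hf : f ∈ (⊤ : Submodule K (FreeLieSuper K deg)) := trivial
  rw [← h] at hf
  exact hf

/-- The superdiagonal of the matrix of `f` depends on the image of `f` in `L` only. -/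
theorem wordRep_sub_mem_upper_two (hab : IsAbelianSuper K L) (f : FreeLieSuper K deg) :
    (wordRep π hb w).lin f - wordMatrix K d w (b.equivFun (π.lin f)) ∈
      SuperMatrix.upper (wordParity d w) 2 := by
  have h := free_le_of_gen_of_br deg ((SuperMatrix.upper (wordParity d w) 2).comap
    ((wordRep π hb w).lin - wordMatrix K d w ∘ₗ b.equivFun.toLinearMap ∘ₗ π.lin)) ?_ ?_
  · have hf : f ∈ (⊤ : Submodule K (FreeLieSuper K deg)) := trivial
    rw [← h] at hf
    exact hf
  · intro x
    change (wordRep π hb w).lin (freeGen K deg x) - wordMatrix K d w (b.equivFun (π.lin _)) ∈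
      SuperMatrix.upper (wordParity d w) 2
    rw [wordRep, freeLift_freeGen, sub_self]
    exact Submodule.zero_mem _
  · intro x y
    change (wordRep π hb w).lin (br K x y) - wordMatrix K d w (b.equivFun (π.lin (br K x y))) ∈
      SuperMatrix.upper (wordParity d w) 2
    rw [π.map_br, hab, map_zero, map_zero, sub_zero, SuperHom.map_br]
    exact SuperMatrix.br_mem_upper (wordRep_mem_upper_one hb w x) (wordRep_mem_upper_one hb w y)

/-- The representation maps `R` above the superdiagonal, and each bracket with `F` raises the
diagonal by one. -/
theorem wordRep_mem_upper_of_mem_gamma (hab : IsAbelianSuper K L) (k : ℕ)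
    {f : FreeLieSuper K deg} (hf : f ∈ (π.ker.gamma k).sub) :
    (wordRep π hb w).lin f ∈ SuperMatrix.upper (wordParity d w) (k + 2) := by
  have h : (π.ker.gamma k).sub ≤
      (SuperMatrix.upper (wordParity d w) (k + 2)).comap (wordRep π hb w).lin := by
    clear hf
    induction k with
    | zero =>
      intro f hf
      have h := wordRep_sub_mem_upper_two (π := π) hb w hab f
      have hf' : π.lin f = 0 := hf
      rw [hf', map_zero, map_zero, sub_zero] at h
      exact h
    | succ k ih =>
      refine Submodule.map₂_le.2 fun x hx y _ => ?_
      change (wordRep π hb w).lin (br K x y) ∈ SuperMatrix.upper (wordParity d w) (k + 1 + 2)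
      rw [SuperHom.map_br, add_right_comm]
      exact SuperMatrix.br_mem_upper (ih hx) (wordRep_mem_upper_one hb w y)
  exact h hf

variable [LinearOrder ι]

/-- In a presentation of an abelian Lie superalgebra, the basic triple brackets of lifts of a basis
are linearly independent modulo `γ₃(R, F)`. -/
theorem hall_independent (hab : IsAbelianSuper K L)
    (hb : ∀ l, b l ∈ (part K (d l) : Submodule K L)) {e : ι → FreeLieSuper K deg}
    (he : ∀ l, π.lin (e l) = b l) (c : HallTriple ι → K)
    (hc : ∑ t, c t • tripleBr K e t.1 ∈ (π.ker.gamma 2).sub) (t : HallTriple ι) : c t = 0 := by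
  set w := dualWord t.1
  obtain ⟨s, hs, H⟩ : ∃ s : K, s ≠ 0 ∧ ∀ t' : HallTriple ι,
      (wordRep π hb w).lin (tripleBr K e t'.1) 0 3 = if t' = t then s else 0 := by
    set p := wordParity d w
    refine ⟨if t.1.1 = t.1.2.2 then -superSign K (p 0 + p 1) (p 1 + p 3) else 1, ?_, ?_⟩
    · split_ifs
      · rcases superSign_eq_one_or K (p 0 + p 1) (p 1 + p 3) with h | h <;> simp [h]
      · exact one_ne_zero
    · intro t'
      have hdiag : ∀ l : ι,
          (wordRep π hb w).lin (e l) 0 1 = Pi.single (M := fun _ : ι => K) l 1 w.1 ∧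
          (wordRep π hb w).lin (e l) 1 2 = Pi.single (M := fun _ : ι => K) l 1 w.2.1 ∧
          (wordRep π hb w).lin (e l) 2 3 = Pi.single (M := fun _ : ι => K) l 1 w.2.2 := by
        intro l
        have h := wordRep_sub_mem_upper_two (π := π) hb w hab (e l)
        have hl : b.equivFun (b l) = Pi.single (M := fun _ : ι => K) l 1 := by
          funext l'
          rw [b.equivFun_self, Pi.single_apply]
          exact if_congr eq_comm rfl rfl
        rw [he, hl] at h
        exact ⟨sub_eq_zero.1 (h 0 1 (by decide)), sub_eq_zero.1 (h 1 2 (by decide)),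
          sub_eq_zero.1 (h 2 3 (by decide))⟩
      rw [tripleBr, SuperHom.map_br, SuperHom.map_br,
        SuperMatrix.br_br_corner (wordRep_mem_upper_one hb w _) (wordRep_mem_upper_one hb w _)
          (wordRep_mem_upper_one hb w _)]
      simp only [hdiag]
      exact dualWord_pairing t t' _ _ _
  have h0 := wordRep_mem_upper_of_mem_gamma hb w hab 2 hc 0 3 (by decide)
  rw [map_sum] at h0
  have h1 : ∀ t', (wordRep π hb w).lin (c t' • tripleBr K e t'.1) 0 3 =
      if t' = t then c t' * s else 0 := by
    intro t'
    rw [map_smul]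
    change c t' * _ = _
    rw [H, mul_ite, mul_zero]
  have h2 : (∑ t', (wordRep π hb w).lin (c t' • tripleBr K e t'.1)) 0 3 =
      ∑ t', (wordRep π hb w).lin (c t' • tripleBr K e t'.1) 0 3 :=
    Matrix.sum_apply (0 : Fin 4) (3 : Fin 4) Finset.univ
      (fun t' => ((wordRep π hb w).lin (c t' • tripleBr K e t'.1) : Matrix (Fin 4) (Fin 4) K))
  rw [h2] at h0
  simp only [h1, Finset.sum_ite_eq', Finset.mem_univ, if_true] at h0
  exact (mul_eq_zero.1 h0).resolve_right hs

omit [Fintype ι] in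
/-- The component of degree `3` of a free Lie superalgebra is spanned by the basic triple brackets
of the letters. -/
theorem lengthComponent_three (φ : ι ≃ X) (hd : ∀ l, deg (φ l) = d l) :
    lengthComponent K deg 3 = Submodule.span K
      (Set.range fun t : HallTriple ι => tripleBr K (fun l => freeGen K deg (φ l)) t.1) := by
  set e : ι → FreeLieSuper K deg := fun l => freeGen K deg (φ l)
  have he : ∀ l, e l ∈ part K (d l) := fun l => hd l ▸ freeGen_mem deg (φ l)
  have hlen : ∀ u : FreeMagma X, u.length = 1 →
      ∃ l, evalMonomial (K := K) (freeGen K deg) u = e l := by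
    intro u hu
    cases u with
    | of x => exact ⟨φ.symm x, by simp [e, evalMonomial]⟩
    | mul u v =>
      have h : u.length + v.length = 1 := hu
      have := u.length_pos
      have := v.length_pos
      omega
  have hlen₂ : ∀ u : FreeMagma X, u.length = 2 →
      ∃ l l', evalMonomial (K := K) (freeGen K deg) u = br K (e l) (e l') := by
    intro u hu
    cases u with
    | of x => exact absurd (show 1 = 2 from hu) (by decide)
    | mul u v =>
      have h : u.length + v.length = 2 := hu
      have := u.length_pos
      have := v.length_pos
      obtain ⟨l, hl⟩ := hlen u (by omega)
      obtain ⟨l', hl'⟩ := hlen v (by omega)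
      exact ⟨l, l', by rw [evalMonomial, hl, hl']⟩
  rw [lengthComponent_eq_span]
  apply le_antisymm
  · rw [Submodule.span_le]
    rintro _ ⟨u, hu, rfl⟩
    cases u with
    | of x => exact absurd (show 1 = 3 from hu) (by decide)
    | mul u v =>
      have h : u.length + v.length = 3 := hu
      have hu0 := u.length_pos
      have hv0 := v.length_pos
      rcases (by omega : u.length = 1 ∧ v.length = 2 ∨ u.length = 2 ∧ v.length = 1) with h' | h'
      · obtain ⟨l, hl⟩ := hlen u h'.1
        obtain ⟨l₁, l₂, hl'⟩ := hlen₂ v h'.2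
        rw [SetLike.mem_coe, evalMonomial, hl, hl']
        exact br_mem_of_swap (he l) (br_mem (he l₁) (he l₂)) (br_br_mem_span_hall he l₁ l₂ l)
      · obtain ⟨l, hl⟩ := hlen v h'.2
        obtain ⟨l₁, l₂, hl'⟩ := hlen₂ u h'.1
        rw [SetLike.mem_coe, evalMonomial, hl, hl']
        exact br_br_mem_span_hall he l₁ l₂ l
  · rw [Submodule.span_le]
    rintro _ ⟨t, rfl⟩
    exact Submodule.subset_span
      ⟨.mul (.mul (.of (φ t.1.1)) (.of (φ t.1.2.1))) (.of (φ t.1.2.2)), rfl, rfl⟩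

theorem SuperHom.exists_lift {F : Type*} [AddCommGroup F] [Module K F] [Superalgebra K F]
    (π : SuperHom K F L) (hπ : Function.Surjective π.lin) {i : ZMod 2} {v : L}
    (hv : v ∈ (part K i : Submodule K L)) : ∃ f ∈ (part K i : Submodule K F), π.lin f = v := by
  obtain ⟨f, rfl⟩ := hπ v
  obtain ⟨f₀, h₀, f₁, h₁, rfl⟩ := Superalgebra.exists_add (K := K) f
  rw [map_add] at hv ⊢
  have h2 : ∀ i : ZMod 2, i = 0 ∨ i = 1 := by decide
  rcases h2 i with rfl | rfl
  · exact ⟨f₀, h₀, fst_unique (π.map_part h₀) (π.map_part h₁) hv (Submodule.zero_mem _)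
      (by rw [add_zero])⟩
  · refine ⟨f₁, h₁, ?_⟩
    have := fst_unique (π.map_part h₀) (π.map_part h₁) (Submodule.zero_mem _) hv (by rw [zero_add])
    rw [this, zero_add]

end Presentation

/-! ### Quotients of graded ideals and bases -/

section Within

variable {K : Type*} [Field K] {F : Type*} [AddCommGroup F] [Module K F] [Superalgebra K F]
  {T : Type*} [Fintype T]

namespace GradedIdeal

theorem linearIndependent_mkQ_within (J I : GradedIdeal K F) (u : T → F) (hu : ∀ t, u t ∈ I.sub)
    (h : ∀ c : T → K, ∑ t, c t • u t ∈ J.sub → ∀ t, c t = 0) :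
    LinearIndependent K fun t => (J.within I).sub.mkQ ⟨u t, hu t⟩ := by
  rw [Fintype.linearIndependent_iff]
  intro c hc
  refine h c ?_
  have e : I.sub.subtype (∑ t, c t • ⟨u t, hu t⟩) ∈ J.sub := by
    refine (Submodule.Quotient.mk_eq_zero (J.within I).sub).1 ?_
    rw [← hc]
    simp only [← map_smul, ← map_sum]
    rfl
  simpa only [map_sum, map_smul, Submodule.subtype_apply] using e

theorem span_mkQ_within (J I : GradedIdeal K F) (u : T → F) (hu : ∀ t, u t ∈ I.sub)
    (h : I.sub ≤ Submodule.span K (Set.range u) ⊔ J.sub) :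
    Submodule.span K (Set.range fun t => (J.within I).sub.mkQ ⟨u t, hu t⟩) = ⊤ := by
  rw [eq_top_iff]
  rintro x -
  obtain ⟨⟨x, hx⟩, rfl⟩ := (J.within I).sub.mkQ_surjective x
  obtain ⟨y, hy, z, hz, hyz⟩ := Submodule.mem_sup.1 (h hx)
  obtain ⟨c, rfl⟩ := (Submodule.mem_span_range_iff_exists_fun K).1 hy
  refine (Submodule.mem_span_range_iff_exists_fun K).2 ⟨c, ?_⟩
  have e : I.sub.subtype (∑ t, c t • ⟨u t, hu t⟩ - ⟨x, hx⟩) ∈ J.sub := by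
    simp only [map_sub, map_sum, map_smul, Submodule.subtype_apply]
    rw [← hyz, sub_add_cancel_left]
    exact Submodule.neg_mem _ hz
  simp only [← map_smul, ← map_sum]
  exact (Submodule.Quotient.eq _).2 e

end GradedIdeal

end Within

/-- Two homogeneous bases with the same parities define a linear isomorphism that preserves and
reflects parity. -/
theorem exists_parity_equiv {K : Type*} [Field K] {M N : Type*} [AddCommGroup M] [Module K M]
    [Superalgebra K M] [AddCommGroup N] [Module K N] [Superalgebra K N] {J : Type*} [Fintype J]
    {d : J → ZMod 2} {h : J → M} {g : J → N} (hh : ∀ j, h j ∈ (part K (d j) : Submodule K M))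
    (hg : ∀ j, g j ∈ (part K (d j) : Submodule K N)) (hli : LinearIndependent K h)
    (gli : LinearIndependent K g) (hspan : Submodule.span K (Set.range h) = ⊤)
    {W : Submodule K N} (hW : W = Submodule.span K (Set.range g)) :
    ∃ e : M ≃ₗ[K] W, ∀ (i : ZMod 2) (x : M),
      x ∈ (part K i : Submodule K M) ↔ (e x : N) ∈ (part K i : Submodule K N) := by
  subst hW
  let B := Module.Basis.mk hli hspan.ge
  let B' := Module.Basis.span gli
  refine ⟨B.equiv B' (Equiv.refl _), fun i x => ?_⟩
  have hx : x = ∑ t, B.repr x t • h t := by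
    conv_lhs => rw [← B.sum_repr x]
    simp only [B, Module.Basis.mk_apply]
  have hex : (B.equiv B' (Equiv.refl _) x : N) = ∑ t, B.repr x t • g t := by
    conv_lhs => rw [← B.sum_repr x]
    simp only [map_sum, map_smul, Module.Basis.equiv_apply, Equiv.refl_apply,
      Submodule.coe_sum, Submodule.coe_smul, B', Module.Basis.span_apply]
  rw [hex, sum_mem_part_iff hg gli]
  conv_lhs => rw [hx]
  exact sum_mem_part_iff hh hli _ i

/-! ### The multiplier -/

theorem corollaryc1 {K : Type*} [Field K] (m n : ℕ)
    {L : Type*} [AddCommGroup L] [Module K L] [Superalgebra K L] [LieSuperalgebra K L]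
    (hab : IsAbelianSuper K L) (hdim : HasSuperdim K L m n)
    {X : Type*} (deg : X → ZMod 2)
    (π : SuperHom K (FreeLieSuper K deg) L) (hπ : Function.Surjective π.lin) :
    ∃ a b : ℕ,
      (a : ℚ) = (1 / 3) * ((m : ℚ) ^ 3 + 3 * (n : ℚ) ^ 2 * m - m) ∧
      (b : ℚ) = (1 / 3) * (3 * (m : ℚ) ^ 2 * n + (n : ℚ) ^ 3 - n) ∧
      IsAbelianSuper K (NilpotentMultiplier 2 π) ∧
      HasSuperdim K (NilpotentMultiplier 2 π) a b ∧
      ∃ e : NilpotentMultiplier 2 π ≃ₗ[K] lengthComponent K (stdDegree m n) 3,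
        ∀ (i : ZMod 2) (x : NilpotentMultiplier 2 π),
          x ∈ Superalgebra.part K i ↔
            (e x : FreeLieSuper K (stdDegree m n)) ∈ Superalgebra.part K i := by
  obtain ⟨b', hb'⟩ := hdim.exists_basis
  set d := letterParity m n
  let b : Module.Basis (Letters m n) K L := b'.reindex toLex
  have hb : ∀ l, b l ∈ (part K (d l) : Submodule K L) := fun l => by
    rw [Module.Basis.reindex_apply]
    exact hb' _
  choose f hf hπf using fun l => π.exists_lift hπ (hb l)
  -- Since `L` is abelian, `γ₂(F) ≤ R`, hence `R ∩ γ₃(F) = γ₃(F)` and `γ₄(F) ≤ γ₃(R, F)`.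
  have hR : (GradedIdeal.top.gamma 1 : GradedIdeal K (FreeLieSuper K deg)).sub ≤ π.ker.sub :=
    Submodule.map₂_le.2 fun x _ y _ => by
      change π.lin (br K x y) = 0
      rw [π.map_br, hab]
  have hle : (GradedIdeal.top.gamma 2 : GradedIdeal K (FreeLieSuper K deg)).sub ≤ π.ker.sub :=
    (Submodule.map₂_le.2 fun x hx y _ => π.ker.right_mem y (hR hx))
  have hmem : ∀ t : HallTriple (Letters m n), tripleBr K f t.1 ∈
      (π.ker.inter (GradedIdeal.top.gamma 2)).sub := fun t =>
    ⟨hle (GradedIdeal.tripleBr_mem_gamma f t.1), GradedIdeal.tripleBr_mem_gamma f t.1⟩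
  let J := (π.ker.gamma 2).within (π.ker.inter (GradedIdeal.top.gamma 2))
  let h : HallTriple (Letters m n) → NilpotentMultiplier 2 π := fun t =>
    J.sub.mkQ ⟨tripleBr K f t.1, hmem t⟩
  have hh : ∀ t, h t ∈ (part K (tripleParity d t.1) : Submodule K (NilpotentMultiplier 2 π)) :=
    fun t => ⟨⟨tripleBr K f t.1, hmem t⟩, tripleBr_mem hf t.1, rfl⟩
  have hli : LinearIndependent K h :=
    GradedIdeal.linearIndependent_mkQ_within _ _ _ hmem (hall_independent hab hb hπf)
  have hgen : ∀ x : FreeLieSuper K deg,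
      ∃ y ∈ Submodule.span K (Set.range f), x - y ∈ π.ker.sub := by
    intro x
    refine ⟨∑ l, b.equivFun (π.lin x) l • f l, Submodule.sum_mem _ fun l _ =>
      Submodule.smul_mem _ _ (Submodule.subset_span ⟨l, rfl⟩), ?_⟩
    change π.lin _ = 0
    rw [map_sub, map_sum]
    simp only [map_smul, hπf]
    rw [b.sum_equivFun, sub_self]
  have hspan : Submodule.span K (Set.range h) = ⊤ :=
    GradedIdeal.span_mkQ_within _ _ _ hmem
      (inf_le_right.trans (GradedIdeal.gamma_two_le_span_hall π.ker hf hgen))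
  -- The letters of `stdDegree m n` present `L` as well.
  let ρ : SuperHom K (FreeLieSuper K (stdDegree m n)) L := freeLift (stdDegree m n) b' hb'
  let g : Letters m n → FreeLieSuper K (stdDegree m n) := fun l =>
    freeGen K (stdDegree m n) (ofLex l)
  have hg : ∀ l, g l ∈ part K (d l) := fun l => freeGen_mem (stdDegree m n) (ofLex l)
  have hρg : ∀ l, ρ.lin (g l) = b l := fun l => by
    rw [Module.Basis.reindex_apply]
    exact freeLift_freeGen _ _ _ _
  have hli' : LinearIndependent K fun t : HallTriple (Letters m n) => tripleBr K g t.1 := by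
    rw [Fintype.linearIndependent_iff]
    intro c hc
    refine hall_independent hab hb hρg c ?_
    rw [hc]
    exact Submodule.zero_mem _
  have hcomp := lengthComponent_three (K := K) (deg := stdDegree m n) (d := d) ofLex fun _ => rfl
  refine ⟨_, _, card_hall_even m n, card_hall_odd m n, ?_,
    ⟨rank_part_eq hh hli hspan 0, rank_part_eq hh hli hspan 1⟩,
    exists_parity_equiv hh (fun t => tripleBr_mem hg t.1) hli hli' hspan hcomp⟩
  intro x y
  obtain ⟨x, rfl⟩ := J.sub.mkQ_surjective x
  obtain ⟨y, rfl⟩ := J.sub.mkQ_surjective y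
  refine (J.br_mkQ x y).trans ((Submodule.Quotient.mk_eq_zero _).2 ?_)
  exact π.ker.top_gamma_succ_le hR 2 (GradedIdeal.br_mem_bracketTop _ x.2.2 y)

end
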